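/- Let $1<q<\infty$, $1<p\le 2$, let $p'$ be given by $\frac1p+\frac1{p'}=1$, and put $\alpha=p'/q$. **Setting.** Let $(\lambda_n)_{n\in\mathbb N}$ be a sequence in the open right half plane $\mathbb C_+=\{\operatorname{Re} z>0\}$ (repetitions allowed), let $A$ be the diagonal operator on $X=\ell_q$ with eigenvalues $\lambda_n$, so that $-A$ generates the semigroup $(S(t)x)_n=e^{-\lambda_n t}x_n$, and let $b=(b_n)$ be a sequence of complex numbers. For $\theta\in\mathbb R$ let $X_{-\theta}=\{(\xi_n): (\xi_n/(1+\lambda_n)^{\theta})_n\in\ell_q\}$ with its natural norm; $S$ acts on $X_{-\theta}$ by the same formula. The sequence $b$ is an *infinite-time $L^p$-admissible input element* for $A$ if $b\in X_{-1}$ and there is a constant $K$ such that for all $\tau>0$, $u\in L^p([0,\tau])$ and $t\in[0,\tau]$ the Bochner integral $\int_0^t S(t-s)\,b\,u(s)\,ds$ in $X_{-1}$ belongs to $X=\ell_q$ and has $\ell_q$-norm at most $K\|u\|_{L^p(0,\tau)}$. **Carleson measures.** For $f\in L^{r}(\mathbb R)$, $1<r<\infty$, let $(\mathcal P f)(t+ix)=\frac1\pi\int_{\mathbb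 R}\frac{t}{t^2+(x-y)^2}f(y)\,dy$ be its Poisson extension to $\mathbb C_+$; these functions form $H^r$, with $\|\mathcal Pf\|_{H^r}=\|f\|_{L^r}$. A non-negative Borel measure $\mu$ on $\mathbb C_+$ is *embedding $\alpha$-Carleson* if there is $M<\infty$ with $\|F\|_{L^q(\mu)}\le M\|F\|_{H^{\alpha q}}$ for all $F\in H^{\alpha q}$ (with the exponent $q$ above, so $\alpha q=p'$). It is *geometric $\alpha$-Carleson* if there is $c<\infty$ with $\mu(T(I))^{\alpha}\le c\,|I|$ for all bounded open intervals $I$, where $T(I)=\mathbb C_+\setminus\bigcup_{x\in\mathbb R\setminus I}\{t+iy: |x-y|<t\}$ is the tent over $I$. Let $\mu=\sum_n|b_n|^q\delta_{\lambda_n}$. (a) If $\mu$ is embedding $\alpha$-Carleson, then $b\in X_{-\theta}$ for every $\theta>\frac1{p'}$ and $b$ is an infinite-time $L^p$-admissible input element for $A$. (b) If $b$ is an infinite-time $L^p$-admissible input element for $A$, then $b\in X_{-\theta}$ for every $\theta>\frac1{p'}$ and $\mu$ is geometric $\alpha$-Carleson. In particular, if $p'\le q$, then $b$ is infinite-time $L^p$-admissible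 for $A$ if and only if $\mu$ is embedding $\alpha$-Carleson, and also if and only if $\mu$ is geometric $\alpha$-Carleson. Moreover, the conclusion of (b) cannot be strengthened to the embedding property in general: for all $p,q$ with $1<p<2$ and $1<q<p'$ there are a sequence $(\lambda_n)$ in $\mathbb C_+$ and a sequence $b$ such that $b$ is infinite-time $L^p$-admissible for the diagonal operator $A$ with eigenvalues $\lambda_n$, but $\mu=\sum_n|b_n|^q\delta_{\lambda_n}$ is not embedding $\alpha$-Carleson. -/

import Mathlib

open MeasureTheory Set
open scoped ENNReal NNReal

noncomputable section

namespace CarlesonAdmissibility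

/-- The open right half plane `ℂ₊`. The half space `ℝ²₊ = ℝ × (0, ∞)` is identified with it through
`(x, t) ↦ t + i x`. -/
abbrev RightHalfPlane : Type := {z : ℂ // 0 < z.re}

/-! ### Carleson measures on the right half plane -/

/-- The Poisson kernel `P_t(x) = t / (π (t² + x²))` of the half plane. -/
def poissonKernel (t x : ℝ) : ℝ := t / (Real.pi * (t ^ 2 + x ^ 2))

/-- The Poisson extension `(𝒫 f)(t + i x) = ∫ P_t(x - y) f(y) dy`. -/
def poissonExt (f : ℝ → ℂ) (z : ℂ) : ℂ :=
  ∫ y : ℝ, (poissonKernel z.re (z.im - y) : ℂ) * f y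

/-- `μ` is an embedding `α`-Carleson measure (tested with the exponent `q`, where `α q > 1`):
`‖F‖_{L^q(μ)} ≤ M ‖F‖_{H^{α q}}` for all `F ∈ H^{α q}`. Here `H^r`, `1 < r < ∞`, consists of the
Poisson extensions `F = 𝒫 f` of the functions `f ∈ L^r(ℝ)`, and `‖𝒫 f‖_{H^r} = ‖f‖_{L^r}`. -/
def IsEmbeddingCarleson (α q : ℝ) (μ : Measure ℂ) : Prop :=
  ∃ M : ℝ≥0, ∀ f : ℝ → ℂ, MemLp f (ENNReal.ofReal (α * q)) volume →
    eLpNorm (poissonExt f) (ENNReal.ofReal q) μ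
      ≤ M * eLpNorm f (ENNReal.ofReal (α * q)) volume

/-- The cone `Γ(x) = {(y, t) : |x - y| < t}` with vertex `x`, as a subset of the half plane. -/
def cone (x : ℝ) : Set ℂ := {z | 0 < z.re ∧ |x - z.im| < z.re}

/-- The tent over `O`: the complement in the half plane of the union of the cones with
vertex outside `O`. -/
def tent (O : Set ℝ) : Set ℂ := {z | 0 < z.re} \ ⋃ x ∈ Oᶜ, cone x

/-- `μ` is a geometric `α`-Carleson measure: `μ(T(I))^α ≤ c |I|` for all bounded intervals `I`. -/
def IsGeometricCarleson (α : ℝ) (μ : Measure ℂ) : Prop :=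
  ∃ c : ℝ≥0, ∀ x y : ℝ, x < y → μ (tent (Ioo x y)) ^ α ≤ c * ENNReal.ofReal (y - x)

/-- The discrete measure `∑ |b_n|^q δ_{λ_n}`. -/
def discreteMeasure (q : ℝ) (lam : ℕ → RightHalfPlane) (b : ℕ → ℂ) : Measure ℂ :=
  Measure.sum fun n => ENNReal.ofReal (‖b n‖ ^ q) • Measure.dirac (lam n : ℂ)

/-! ### The spaces `X_{-θ}` of a diagonal operator on `X = ℓ_q` -/

/-- `X_{-θ} = {ξ : (ξ_n / (1 + λ_n)^θ) ∈ ℓ_q}`, for the diagonal operator `A` on `X = ℓ_q` with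
eigenvalues `λ_n`. -/
def extrapolation (q : ℝ) (lam : ℕ → RightHalfPlane) (θ : ℝ) : Submodule ℂ (ℕ → ℂ) where
  carrier := {ξ | Memℓp (fun n => ξ n / (1 + (lam n : ℂ)) ^ (θ : ℂ)) (ENNReal.ofReal q)}
  add_mem' {ξ η} h₁ h₂ := by
    have h := Memℓp.add h₁ h₂
    simp only [mem_ofPred_eq, Pi.add_apply, add_div]
    exact h
  zero_mem' := by
    simp only [mem_ofPred_eq, Pi.zero_apply, zero_div]
    exact zero_memℓp
  smul_mem' c ξ h := by
    have h := Memℓp.const_smul h c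
    simp only [mem_ofPred_eq, Pi.smul_apply, smul_eq_mul, mul_div_assoc]
    exact h

lemma weight_ne_zero (z : RightHalfPlane) (θ : ℝ) : (1 + (z : ℂ)) ^ (θ : ℂ) ≠ 0 := by
  have h : 1 + (z : ℂ) ≠ 0 := fun h => by
    have h' := congrArg Complex.re h
    have hz := z.2
    simp at h'
    linarith
  simp [Complex.cpow_eq_zero_iff, h]

/-- `X_{-θ}` as a type of its own, carrying the norm `‖ξ‖ = ‖(1 + A)^{-θ} ξ‖_{ℓ_q}`. -/
def ExtrapolationSpace (q : ℝ) (lam : ℕ → RightHalfPlane) (θ : ℝ) : Type :=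
  extrapolation q lam θ

namespace ExtrapolationSpace

variable {q : ℝ} {lam : ℕ → RightHalfPlane} {θ : ℝ}

instance : AddCommGroup (ExtrapolationSpace q lam θ) :=
  inferInstanceAs (AddCommGroup (extrapolation q lam θ))

instance : Module ℂ (ExtrapolationSpace q lam θ) :=
  inferInstanceAs (Module ℂ (extrapolation q lam θ))

/-- The element of `X_{-θ}` given by a sequence. -/
def mk (ξ : ℕ → ℂ) (h : ξ ∈ extrapolation q lam θ) : ExtrapolationSpace q lam θ := ⟨ξ, h⟩

/-- The sequence underlying an element of `X_{-θ}`. -/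
def toSeq (ξ : ExtrapolationSpace q lam θ) : ℕ → ℂ := Subtype.val ξ

/-- The map `(1 + A)^{-θ} : X_{-θ} → ℓ_q`. -/
def toLp : ExtrapolationSpace q lam θ →ₗ[ℂ] lp (fun _ : ℕ => ℂ) (ENNReal.ofReal q) where
  toFun ξ := ⟨fun n => ξ.toSeq n / (1 + (lam n : ℂ)) ^ (θ : ℂ), ξ.2⟩
  map_add' ξ η := by
    ext n
    exact add_div (ξ.toSeq n) (η.toSeq n) _
  map_smul' c ξ := by
    ext n
    exact mul_div_assoc c (ξ.toSeq n) _

lemma toLp_bijective :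
    Function.Bijective (toLp : ExtrapolationSpace q lam θ →ₗ[ℂ] _) := by
  constructor
  · intro ξ η h
    apply Subtype.ext
    funext n
    have hn : ξ.toSeq n / (1 + (lam n : ℂ)) ^ (θ : ℂ) = η.toSeq n / (1 + (lam n : ℂ)) ^ (θ : ℂ) :=
      congrFun (congrArg Subtype.val h) n
    exact (div_left_inj' (weight_ne_zero (lam n) θ)).1 hn
  · intro x
    have hx : (fun n => x n * (1 + (lam n : ℂ)) ^ (θ : ℂ) / (1 + (lam n : ℂ)) ^ (θ : ℂ)) = x :=
      funext fun n => mul_div_cancel_right₀ _ (weight_ne_zero (lam n) θ)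
    refine ⟨⟨fun n => x n * (1 + (lam n : ℂ)) ^ (θ : ℂ), ?_⟩, ?_⟩
    · change Memℓp _ _
      rw [hx]
      exact x.2
    · apply Subtype.ext
      exact hx

instance [Fact (1 ≤ ENNReal.ofReal q)] : NormedAddCommGroup (ExtrapolationSpace q lam θ) :=
  NormedAddCommGroup.induced _ (lp (fun _ : ℕ => ℂ) (ENNReal.ofReal q)) toLp toLp_bijective.1

instance [Fact (1 ≤ ENNReal.ofReal q)] : NormedSpace ℂ (ExtrapolationSpace q lam θ) :=
  NormedSpace.induced ℂ _ (lp (fun _ : ℕ => ℂ) (ENNReal.ofReal q)) toLp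

/-- `(1 + A)^{-θ}` is an isometric isomorphism of `X_{-θ}` onto `ℓ_q`. -/
def isometryEquiv [Fact (1 ≤ ENNReal.ofReal q)] :
    ExtrapolationSpace q lam θ ≃ₗᵢ[ℂ] lp (fun _ : ℕ => ℂ) (ENNReal.ofReal q) where
  toLinearEquiv := LinearEquiv.ofBijective toLp toLp_bijective
  norm_map' _ := rfl

instance [Fact (1 ≤ ENNReal.ofReal q)] : CompleteSpace (ExtrapolationSpace q lam θ) :=
  (isometryEquiv (q := q) (lam := lam) (θ := θ)).toIsometryEquiv.completeSpace

end ExtrapolationSpace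

lemma semigroup_mem {q : ℝ} {lam : ℕ → RightHalfPlane} {θ : ℝ} (t : ℝ≥0) {ξ : ℕ → ℂ}
    (h : ξ ∈ extrapolation q lam θ) :
    (fun n => Complex.exp (-(lam n : ℂ) * (t : ℝ)) * ξ n) ∈ extrapolation q lam θ := by
  have h' : Memℓp (fun n => ξ n / (1 + (lam n : ℂ)) ^ (θ : ℂ)) (ENNReal.ofReal q) := h
  change Memℓp _ _
  refine h'.mono' fun n => ?_
  rw [mul_div_assoc, norm_mul]
  refine mul_le_of_le_one_left (norm_nonneg _) ?_
  rw [Complex.norm_exp, Real.exp_le_one_iff]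
  have := mul_nonneg (lam n).2.le t.2
  simpa using this

/-- The semigroup `S(t)` generated by `-A`, extended to `X_{-θ}`: `(S(t) ξ)_n = e^{-λ_n t} ξ_n`. -/
def semigroup {q : ℝ} {lam : ℕ → RightHalfPlane} {θ : ℝ} (t : ℝ≥0)
    (ξ : ExtrapolationSpace q lam θ) : ExtrapolationSpace q lam θ :=
  ExtrapolationSpace.mk (fun n => Complex.exp (-(lam n : ℂ) * (t : ℝ)) * ξ.toSeq n)
    (semigroup_mem t ξ.2)

/-- `b` is an infinite-time `L^p`-admissible input element for the diagonal operator `A` on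
`X = ℓ_q` with eigenvalues `λ_n`: `b ∈ X_{-1}`, and there is a constant `K` such that for all
`τ > 0`, `u ∈ L^p([0, τ])` and `t ∈ [0, τ]` the Bochner integral `∫_0^t S(t - s) b u(s) ds`, taken
in `X_{-1}`, lies in `X = ℓ_q` and has `ℓ_q`-norm at most `K ‖u‖_{L^p(0, τ)}`. -/
def IsAdmissible (p : ℝ) {q : ℝ} (hq : 1 < q) (lam : ℕ → RightHalfPlane) (b : ℕ → ℂ) : Prop :=
  haveI : Fact (1 ≤ ENNReal.ofReal q) := ⟨ENNReal.one_le_ofReal.2 hq.le⟩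
  ∃ hb : b ∈ extrapolation q lam 1, ∃ K : ℝ, ∀ τ : ℝ, 0 < τ → ∀ u : ℝ → ℂ,
    MemLp u (ENNReal.ofReal p) (volume.restrict (Icc 0 τ)) → ∀ t ∈ Icc 0 τ,
      ∃ x : lp (fun _ : ℕ => ℂ) (ENNReal.ofReal q),
        (x : ℕ → ℂ) = (∫ s in (0 : ℝ)..t,
          u s • semigroup (t - s).toNNReal (ExtrapolationSpace.mk b hb)).toSeq ∧
        ‖x‖ ≤ K * (eLpNorm u (ENNReal.ofReal p) (volume.restrict (Icc 0 τ))).toReal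

end CarlesonAdmissibility

end

open MeasureTheory Set
open scoped ENNReal NNReal

namespace CarlesonAdmissibility

/-! ### Layer cake formula for powers in `ℝ≥0∞` -/

/-! The pivot is the Laplace-Carleson inequality `LaplaceCarleson`: `u ↦ 𝓛u` is bounded from `L^p(0,
τ)` to `L^q(μ)`, uniformly in `τ`. The `n`-th coordinate of the input integral is `b_n` times the
Laplace transform, at `λ_n`, of the time-reversed input. Its `ℓ_q`-norm is therefore an
`L^q(μ)`-norm of a Laplace transform, and reversal preserves `L^p`. So admissibility is this
inequality together with `b ∈ X_{-1}`, and the latter follows from the inequality itself.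

Embedding implies the inequality: `𝓛u` is the Poisson extension of the rescaled Fourier transform of
`u` cut off to `[0, τ]` (`poissonExt_fourier`), and Hausdorff-Young, which needs `p ≤ 2`, puts that
transform in `L^{p'}`.

The inequality implies the geometric condition: a pure oscillation at the centre of `I`, on a time
interval of length comparable to `1/|I|`, has `|𝓛u| ≳ 1/|I|` on the whole tent
(`le_norm_laplace_exp`). Summing the geometric condition over dyadic tents around `0` gives `b ∈
X_{-θ}` for `θ > 1/p'`.

If `p' ≤ q`, i.e. `α ≤ 1`, the geometric condition gives back the embedding (Carleson, Duren). A
Vitali covering bounds the level sets of a Poisson extension by tents, which is a weak type `(1,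
1/α)` estimate (`measure_lt_poissonLintegral_le`), and interpolation with `L^∞` finishes.

If `q < p'` and `p < 2`, take `λ_n = 2^n` and `b_n = 2^{n/p'} (n+1)^{-δ}`. For `u ∈ L^p` the
sequence `2^{n/p'} 𝓛u(2^n)` lies in `ℓ_p` (`exists_tsum_laplace_two_pow_le`), whereas Poisson
extensions of `L^{p'}` functions can decay as slowly as `ℓ_{p'}` permits. Since `p < p'`, some `δ`
makes `(n+1)^{-δ}` map `ℓ_p` into `ℓ_q` without making the embedding true. -/

lemma lintegral_Ioo_rpow {β : ℝ} (hβ : 0 < β) {y : ℝ} (hy : 0 ≤ y) :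
    ∫⁻ s in Ioo 0 y, ENNReal.ofReal (β * s ^ (β - 1)) = ENNReal.ofReal (y ^ β) := by
  have hint : IntegrableOn (fun s : ℝ => β * s ^ (β - 1)) (Ioo 0 y) := by
    have := (intervalIntegral.intervalIntegrable_rpow' (a := 0) (b := y) (r := β - 1)
      (by linarith)).const_mul β
    rw [intervalIntegrable_iff_integrableOn_Ioo_of_le hy] at this
    exact this
  rw [← ofReal_integral_eq_lintegral_ofReal hint]
  · congr 1
    rw [← integral_Ioc_eq_integral_Ioo, ← intervalIntegral.integral_of_le hy,
      intervalIntegral.integral_const_mul, integral_rpow (Or.inl (by linarith))]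
    simp [Real.zero_rpow hβ.ne']
    field_simp
  · exact (ae_restrict_mem measurableSet_Ioo).mono fun s hs =>
      mul_nonneg hβ.le (Real.rpow_nonneg hs.1.le _)

/-- Stated for a single extended number, so that one identity both opens the layer cake and
evaluates the inner integral left by Fubini in the two interpolation arguments below. -/
lemma lintegral_indicator_rpow {β : ℝ} (hβ : 0 < β) (x : ℝ≥0∞) :
    ∫⁻ s in Ioi (0 : ℝ), {s | ENNReal.ofReal s < x}.indicator
      (fun s => ENNReal.ofReal (β * s ^ (β - 1))) s = x ^ β := by
  have hm : MeasurableSet {s : ℝ | ENNReal.ofReal s < x} :=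
    measurableSet_lt ENNReal.measurable_ofReal measurable_const
  rw [setLIntegral_indicator hm]
  induction x with
  | top =>
    rw [ENNReal.top_rpow_of_pos hβ]
    refine ENNReal.eq_top_of_forall_nnreal_le fun r => ?_
    -- For `x = ∞`, the interval up to `r^{1/β}` alone already contributes `r`, for every finite
    -- `r`.
    have h := lintegral_Ioo_rpow hβ (y := (r : ℝ) ^ (β⁻¹)) (by positivity)
    rw [← Real.rpow_mul r.coe_nonneg, inv_mul_cancel₀ hβ.ne', Real.rpow_one, ENNReal.ofReal_coe_nnreal] at h
    rw [← h]
    exact lintegral_mono_set fun s hs => ⟨ENNReal.ofReal_lt_top, hs.1⟩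
  | coe x =>
    have : {s : ℝ | ENNReal.ofReal s < (x : ℝ≥0∞)} ∩ Ioi 0 = Ioo 0 (x : ℝ) := by
      ext s
      constructor
      · rintro ⟨h1, h2⟩
        refine ⟨h2, ?_⟩
        rw [mem_ofPred_eq, ← ENNReal.ofReal_coe_nnreal, ENNReal.ofReal_lt_ofReal_iff_of_nonneg
          (le_of_lt h2)] at h1
        exact h1
      · rintro ⟨h1, h2⟩
        refine ⟨?_, h1⟩
        rw [mem_ofPred_eq, ← ENNReal.ofReal_coe_nnreal, ENNReal.ofReal_lt_ofReal_iff_of_nonneg h1.le]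
        exact h2
    rw [this, lintegral_Ioo_rpow hβ x.coe_nonneg, ← ENNReal.ofReal_rpow_of_nonneg x.coe_nonneg hβ.le,
      ENNReal.ofReal_coe_nnreal]

lemma lintegral_rpow_eq_lintegral_meas_lt {X : Type*} [MeasurableSpace X] {μ : Measure X}
    [SFinite μ] {G : X → ℝ≥0∞} (hG : Measurable G) {β : ℝ} (hβ : 0 < β) :
    ∫⁻ z, G z ^ β ∂μ = ∫⁻ s in Ioi (0 : ℝ),
      ENNReal.ofReal (β * s ^ (β - 1)) * μ {z | ENNReal.ofReal s < G z} := by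
  have hm : Measurable fun w : X × ℝ => {w : X × ℝ | ENNReal.ofReal w.2 < G w.1}.indicator
      (fun w => ENNReal.ofReal (β * w.2 ^ (β - 1))) w := by
    refine Measurable.indicator (by fun_prop) (measurableSet_lt (by fun_prop) (by fun_prop))
  calc ∫⁻ z, G z ^ β ∂μ
      = ∫⁻ z, (∫⁻ s in Ioi (0 : ℝ), {s | ENNReal.ofReal s < G z}.indicator
          (fun s => ENNReal.ofReal (β * s ^ (β - 1))) s) ∂μ := by
        simp_rw [lintegral_indicator_rpow hβ]
    _ = ∫⁻ s in Ioi (0 : ℝ), (∫⁻ z, {z | ENNReal.ofReal s < G z}.indicator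
          (fun _ => ENNReal.ofReal (β * s ^ (β - 1))) z ∂μ) := by
        rw [lintegral_lintegral_swap hm.aemeasurable]
        rfl
    _ = _ := by
        refine lintegral_congr fun s => ?_
        rw [lintegral_indicator (measurableSet_lt measurable_const hG)]
        simp

section

/-! ### The Fourier transform: Plancherel and Hausdorff-Young -/

open scoped FourierTransform SchwartzMap ContDiff

lemma continuous_fourier_of_integrable {u : ℝ → ℂ} (hu : Integrable u) : Continuous (𝓕 u) :=
  VectorFourier.fourierIntegral_continuous Real.continuous_fourierChar
    (by exact continuous_inner) hu

lemma enorm_fourier_le {u : ℝ → ℂ} (ξ : ℝ) : ‖𝓕 u ξ‖ₑ ≤ ∫⁻ s, ‖u s‖ₑ := by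
  rw [Real.fourier_eq]
  refine (enorm_integral_le_lintegral_enorm _).trans (le_of_eq ?_)
  refine lintegral_congr fun s => ?_
  rw [enorm_eq_iff_norm_eq.2 (Circle.norm_smul _ _)]

lemma integral_fourier_Lp (v : Lp ℂ 2 (volume : Measure ℝ)) (G : 𝓢(ℝ, ℂ)) :
    ∫ x, (𝓕 G) x • v x = ∫ x, G x • (𝓕 v : Lp ℂ 2 (volume : Measure ℝ)) x := by
  have h1 := congrArg (fun T => T G) (Lp.fourier_toTemperedDistribution_eq v)
  rw [TemperedDistribution.fourier_apply, Lp.toTemperedDistribution_apply,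
    Lp.toTemperedDistribution_apply] at h1
  exact h1

lemma integral_fourier_mul_schwartz {u : ℝ → ℂ} (hu : Integrable u) (G : 𝓢(ℝ, ℂ)) :
    ∫ x, 𝓕 u x • G x = ∫ x, u x • (𝓕 G) x := by
  have h2 := VectorFourier.integral_fourierIntegral_smul_eq_flip (L := innerₗ ℝ)
      Real.continuous_fourierChar continuous_inner hu (G.integrable (μ := volume))
  rw [flip_innerₗ] at h2
  rw [SchwartzMap.fourier_coe]
  exact h2

/-- The `L²` transform, defined by extension, and the integral transform have the same pairing with
smooth compactly supported functions, because in both cases the transform moves onto the test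
function. This makes Plancherel available on `L¹ ∩ L²`. -/
lemma fourier_ae_eq_of_ae_eq {u : ℝ → ℂ} (hu : Integrable u) (v : Lp ℂ 2 (volume : Measure ℝ))
    (huv : v =ᵐ[volume] u) (w : Lp ℂ 2 (volume : Measure ℝ)) (hw : w = 𝓕 v) :
    w =ᵐ[volume] 𝓕 u := by
  have hw2 : MemLp w 2 volume := Lp.memLp w
  refine ae_eq_of_integral_contDiff_smul_eq
    (hw2.locallyIntegrable (by norm_num))
    (continuous_fourier_of_integrable hu).locallyIntegrable fun g hg hgc => ?_
  have hgc' : HasCompactSupport fun x => (g x : ℂ) :=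
    hgc.comp_left (g := fun x : ℝ => (x : ℂ)) Complex.ofReal_zero
  have hg' : ContDiff ℝ ∞ fun x => (g x : ℂ) := Complex.ofRealCLM.contDiff.comp hg
  obtain ⟨G, hG⟩ : ∃ G : 𝓢(ℝ, ℂ), ∀ x, G x = g x := ⟨hgc'.toSchwartzMap hg', fun x => rfl⟩
  calc ∫ x, g x • w x = ∫ x, G x • w x := by simp only [hG, Complex.real_smul, smul_eq_mul]
    _ = ∫ x, (𝓕 G) x • v x := by rw [hw, integral_fourier_Lp]
    _ = ∫ x, u x • (𝓕 G) x := by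
        refine integral_congr_ae (huv.mono fun x hx => ?_)
        simp only [hx, smul_eq_mul, mul_comm]
    _ = ∫ x, 𝓕 u x • G x := (integral_fourier_mul_schwartz hu G).symm
    _ = _ := by simp only [hG, Complex.real_smul, smul_eq_mul, mul_comm]

lemma eLpNorm_fourier_two {u : ℝ → ℂ} (hu : Integrable u) (hu2 : MemLp u 2) :
    eLpNorm (𝓕 u) 2 volume = eLpNorm u 2 volume := by
  rw [← eLpNorm_congr_ae (fourier_ae_eq_of_ae_eq hu _ hu2.coeFn_toLp _ rfl), ← eLpNorm_congr_ae hu2.coeFn_toLp]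
  have := Lp.norm_fourier_eq (hu2.toLp u)
  rwa [Lp.norm_def, Lp.norm_def, ENNReal.toReal_eq_toReal_iff' (Lp.eLpNorm_ne_top _)
    (Lp.eLpNorm_ne_top _)] at this

lemma lintegral_fourier_sq {u : ℝ → ℂ} (hu : Integrable u) (hu2 : MemLp u 2) :
    ∫⁻ ξ, ‖𝓕 u ξ‖ₑ ^ (2 : ℝ) = ∫⁻ s, ‖u s‖ₑ ^ (2 : ℝ) := by
  have h := eLpNorm_fourier_two hu hu2
  rw [eLpNorm_eq_lintegral_rpow_enorm_toReal (by norm_num) (by norm_num),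
    eLpNorm_eq_lintegral_rpow_enorm_toReal (by norm_num) (by norm_num)] at h
  have := congrArg (fun x => x ^ (2 : ℝ)) h
  simpa only [ENNReal.toReal_ofNat, one_div, ← ENNReal.rpow_mul,
    inv_mul_cancel₀ (two_ne_zero (α := ℝ)), ENNReal.rpow_one] using this

end

/-! ### The Hausdorff-Young inequality by interpolation -/

section

open scoped FourierTransform

lemma fourier_congr_ae {u v : ℝ → ℂ} (h : u =ᵐ[volume] v) : 𝓕 u = 𝓕 v := by
  funext ξ
  rw [Real.fourier_eq, Real.fourier_eq]
  exact integral_congr_ae (h.mono fun x hx => by simp only [hx])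

lemma fourier_eq_add {u v w : ℝ → ℂ} (hv : Integrable v) (hw : Integrable w) (h : u = v + w)
    (ξ : ℝ) : 𝓕 u ξ = 𝓕 v ξ + 𝓕 w ξ := by
  have := VectorFourier.fourierIntegral_add (L := innerₗ ℝ) Real.continuous_fourierChar
    (by exact continuous_inner) hv hw
  rw [h]
  exact (congrFun this ξ)

/-- Weak type estimate behind the Hausdorff-Young inequality: `u` is split along the set `E` into
a part with small `L¹` norm and a part which is estimated in `L²`. -/
lemma volume_lt_fourier_le {u : ℝ → ℂ} (hu : Integrable u) {E : Set ℝ} (hE : MeasurableSet E)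
    {s : ℝ} (hs : 0 < s) (h1 : ∫⁻ x in Eᶜ, ‖u x‖ₑ ≤ ENNReal.ofReal (s / 2)) :
    volume {ξ | ENNReal.ofReal s < ‖𝓕 u ξ‖ₑ} ≤
      ENNReal.ofReal (4 * s ^ (-2 : ℝ)) * ∫⁻ x, E.indicator (fun x => ‖u x‖ₑ ^ (2 : ℝ)) x := by
  have hs4 : 0 < 4 * s ^ (-2 : ℝ) := by positivity
  have hnorm : ∀ x, E.indicator (fun x => ‖u x‖ₑ ^ (2 : ℝ)) x = ‖E.indicator u x‖ₑ ^ (2 : ℝ) := by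
    intro x
    by_cases hx : x ∈ E <;> simp [hx]
  simp_rw [hnorm]
  by_cases hfin : ∫⁻ x, ‖E.indicator u x‖ₑ ^ (2 : ℝ) = ∞
  · rw [hfin, ENNReal.mul_top (ENNReal.ofReal_pos.2 hs4).ne']
    exact le_top
  have hu2 : Integrable (E.indicator u) := hu.indicator hE
  have hu1 : Integrable (Eᶜ.indicator u) := hu.indicator hE.compl
  have hmem : MemLp (E.indicator u) 2 := by
    refine ⟨hu2.aestronglyMeasurable, ?_⟩
    rw [eLpNorm_lt_top_iff_lintegral_rpow_enorm_lt_top (by norm_num) (by norm_num)]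
    simpa using lt_top_iff_ne_top.2 hfin
  rw [← lintegral_fourier_sq hu2 hmem]
  -- The part of `u` off `E` has transform at most `s/2` everywhere, so the part on `E` must exceed
  -- `s/2`. Chebyshev and Plancherel then give the constant `(s/2)^{-2} = 4 s^{-2}`.
  have hsub : {ξ | ENNReal.ofReal s < ‖𝓕 u ξ‖ₑ} ⊆
      {ξ | ENNReal.ofReal (s / 2) ^ (2 : ℝ) ≤ ‖𝓕 (E.indicator u) ξ‖ₑ ^ (2 : ℝ)} := by
    intro ξ hξ
    refine ENNReal.rpow_le_rpow ?_ (by norm_num)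
    by_contra! hlt
    have h3 : ‖𝓕 (Eᶜ.indicator u) ξ‖ₑ ≤ ENNReal.ofReal (s / 2) := by
      refine (enorm_fourier_le ξ).trans (le_trans (le_of_eq ?_) h1)
      rw [← lintegral_indicator hE.compl]
      refine lintegral_congr fun x => ?_
      by_cases hx : x ∈ E <;> simp [hx]
    have h4 : ‖𝓕 u ξ‖ₑ ≤ ENNReal.ofReal s := by
      rw [fourier_eq_add hu1 hu2 (indicator_compl_add_self E u).symm, ← add_halves s,
        ENNReal.ofReal_add (by positivity) (by positivity)]
      exact (enorm_add_le _ _).trans (add_le_add h3 hlt.le)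
    exact absurd hξ (not_lt.2 h4)
  refine (measure_mono hsub).trans ?_
  refine (meas_ge_le_lintegral_div ?_ ?_ ?_).trans ?_
  · exact ((continuous_fourier_of_integrable hu2).measurable.enorm.pow_const _).aemeasurable
  · simp [hs]
  · simp
  · rw [ENNReal.div_eq_inv_mul]
    gcongr
    rw [ENNReal.ofReal_rpow_of_pos (by positivity), ← ENNReal.ofReal_inv_of_pos (by positivity)]
    refine ENNReal.ofReal_le_ofReal (le_of_eq ?_)
    rw [Real.rpow_neg hs.le, Real.div_rpow hs.le (by norm_num)]
    norm_num
    ring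

/-- Conjugacy gives `(p - 1)(p' - 2) = 2 - p`, so the powers of `x` recombine to exactly `x^p`. -/
lemma rpow_mul_div_rpow_le {p p' : ℝ} (hpp' : p + p' = p * p')
    (hp' : 2 < p') (a x : ℝ≥0∞) (hx : x ≠ ∞) :
    x ^ (2 : ℝ) * (a / x ^ (p - 1)) ^ (p' - 2) ≤ a ^ (p' - 2) * x ^ p := by
  rcases eq_or_ne x 0 with rfl | h0
  · simp
  rw [ENNReal.div_rpow_of_nonneg _ _ (by linarith), ← ENNReal.rpow_mul,
    show (p - 1) * (p' - 2) = 2 - p by linarith, ENNReal.div_eq_inv_mul, ← ENNReal.rpow_neg,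
    ← mul_assoc, ← ENNReal.rpow_add _ _ h0 hx, mul_comm]
  ring_nf
  exact le_rfl

/-- Interpolation between `L¹ → L^∞` and `L² → L²`, with a splitting of `u` that varies with the
level `s`. Building the total mass `A` into the threshold gives the homogeneous power `A^{p'-1}`
directly. -/
lemma lintegral_fourier_rpow_le {p p' : ℝ} (hp : 1 < p) (hpp' : p + p' = p * p')
    (hp' : 2 < p') {u : ℝ → ℂ} (hm : Measurable u) (hu : Integrable u)
    (hA0 : ∫⁻ x, ‖u x‖ₑ ^ p ≠ 0) (hA : ∫⁻ x, ‖u x‖ₑ ^ p ≠ ∞) :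
    ∫⁻ ξ, ‖𝓕 u ξ‖ₑ ^ p' ≤ ENNReal.ofReal (4 * p' / (p' - 2) * 2 ^ (p' - 2)) *
      (∫⁻ x, ‖u x‖ₑ ^ p) ^ (p' - 1) := by
  obtain ⟨A, hAdef⟩ : ∃ A, ∫⁻ x, ‖u x‖ₑ ^ p = A := ⟨_, rfl⟩
  rw [hAdef] at hA0 hA ⊢
  have hp'2 : 0 < p' - 2 := by linarith
  have hp'0 : 0 < p' := by linarith
  -- Off `E s` one has `|u| ≤ s |u|^p / (2A)`, so that part has `L¹`-norm at most `s/2`, as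
  -- `volume_lt_fourier_le` requires.
  let E : ℝ → Set ℝ := fun s => {x | ENNReal.ofReal s < 2 * A / ‖u x‖ₑ ^ (p - 1)}
  have hEm : ∀ s, MeasurableSet (E s) := fun s =>
    measurableSet_lt measurable_const (measurable_const.div (hm.enorm.pow_const _))
  have hsmall : ∀ s, 0 < s → ∫⁻ x in (E s)ᶜ, ‖u x‖ₑ ≤ ENNReal.ofReal (s / 2) := by
    intro s hs
    have h1 : ∫⁻ x in (E s)ᶜ, 2 * A * ‖u x‖ₑ ≤ ∫⁻ x in (E s)ᶜ, ENNReal.ofReal s * ‖u x‖ₑ ^ p := by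
      refine setLIntegral_mono' (hEm s).compl fun x hx => ?_
      have hx' : 2 * A / ‖u x‖ₑ ^ (p - 1) ≤ ENNReal.ofReal s := not_lt.1 hx
      rcases eq_or_ne ‖u x‖ₑ 0 with h0 | h0
      · simp [h0]
      rw [ENNReal.div_le_iff (by simp [ENNReal.rpow_eq_zero_iff, h0])
        (ENNReal.rpow_ne_top_of_nonneg (by linarith) enorm_ne_top)] at hx'
      calc 2 * A * ‖u x‖ₑ ≤ ENNReal.ofReal s * ‖u x‖ₑ ^ (p - 1) * ‖u x‖ₑ := by gcongr
        _ = ENNReal.ofReal s * ‖u x‖ₑ ^ p := by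
          rw [mul_assoc]
          congr 1
          conv_lhs => rw [← ENNReal.rpow_one ‖u x‖ₑ, ← ENNReal.rpow_mul,
            ← ENNReal.rpow_add _ _ h0 enorm_ne_top]
          ring_nf
    rw [lintegral_const_mul _ hm.enorm, lintegral_const_mul _ (hm.enorm.pow_const _)] at h1
    have h2 : 2 * A * ∫⁻ x in (E s)ᶜ, ‖u x‖ₑ ≤ 2 * A * ENNReal.ofReal (s / 2) := by
      refine h1.trans ?_
      calc ENNReal.ofReal s * ∫⁻ x in (E s)ᶜ, ‖u x‖ₑ ^ p ≤ ENNReal.ofReal s * A := by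
            gcongr
            exact (setLIntegral_le_lintegral _ _).trans_eq hAdef
        _ = 2 * A * ENNReal.ofReal (s / 2) := by
            rw [show s = 2 * (s / 2) by ring, ENNReal.ofReal_mul (by norm_num)]
            simp
            ring
    rwa [ENNReal.mul_le_mul_iff_right (by simp [hA0]) (by finiteness)] at h2
  have hjm : Measurable fun w : ℝ × ℝ => {w : ℝ × ℝ | ENNReal.ofReal w.1 <
      2 * A / ‖u w.2‖ₑ ^ (p - 1)}.indicator (fun w => ENNReal.ofReal ((p' - 2) * w.1 ^ (p' - 2 - 1)) *
        ‖u w.2‖ₑ ^ (2 : ℝ)) w := by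
    refine Measurable.indicator (by fun_prop) (measurableSet_lt (by fun_prop) ?_)
    exact measurable_const.div ((hm.comp measurable_snd).enorm.pow_const _)
  have hc : 0 ≤ 4 * p' / (p' - 2) := by positivity
  calc ∫⁻ ξ, ‖𝓕 u ξ‖ₑ ^ p'
      = ∫⁻ s in Ioi (0 : ℝ), ENNReal.ofReal (p' * s ^ (p' - 1)) *
          volume {ξ | ENNReal.ofReal s < ‖𝓕 u ξ‖ₑ} :=
        lintegral_rpow_eq_lintegral_meas_lt
          (continuous_fourier_of_integrable hu).measurable.enorm hp'0
    _ ≤ ∫⁻ s in Ioi (0 : ℝ), ENNReal.ofReal (4 * p' / (p' - 2)) *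
          ∫⁻ x, {w : ℝ × ℝ | ENNReal.ofReal w.1 <
      2 * A / ‖u w.2‖ₑ ^ (p - 1)}.indicator (fun w => ENNReal.ofReal ((p' - 2) * w.1 ^ (p' - 2 - 1)) *
        ‖u w.2‖ₑ ^ (2 : ℝ)) (s, x) := by
        refine setLIntegral_mono' measurableSet_Ioi fun s hs => ?_
        have hs : 0 < s := hs
        refine (mul_le_mul_right (volume_lt_fourier_le hu (hEm s) hs (hsmall s hs)) _).trans ?_
        rw [← mul_assoc, ← ENNReal.ofReal_mul (by positivity)]
        have : p' * s ^ (p' - 1) * (4 * s ^ (-2 : ℝ)) =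
            4 * p' / (p' - 2) * ((p' - 2) * s ^ (p' - 2 - 1)) := by
          rw [show p' - 2 - 1 = p' - 1 + (-2) by ring, Real.rpow_add hs]
          field_simp
        rw [this, ENNReal.ofReal_mul hc, mul_assoc, ← lintegral_const_mul' _ _ (by finiteness)]
        gcongr with x
        by_cases hx : x ∈ E s
        · have hx' : (s, x) ∈ {w : ℝ × ℝ | ENNReal.ofReal w.1 < 2 * A / ‖u w.2‖ₑ ^ (p - 1)} := hx
          rw [indicator_of_mem hx, indicator_of_mem hx']
        · simp [hx]
    _ = ENNReal.ofReal (4 * p' / (p' - 2)) * ∫⁻ x, ‖u x‖ₑ ^ (2 : ℝ) *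
          ∫⁻ s in Ioi (0 : ℝ), {s | ENNReal.ofReal s < 2 * A / ‖u x‖ₑ ^ (p - 1)}.indicator
            (fun s => ENNReal.ofReal ((p' - 2) * s ^ (p' - 2 - 1))) s := by
        rw [lintegral_const_mul' _ _ ENNReal.ofReal_ne_top, lintegral_lintegral_swap hjm.aemeasurable]
        congr 1
        refine lintegral_congr fun x => ?_
        rw [← lintegral_const_mul' _ _ (by finiteness)]
        refine lintegral_congr fun s => ?_
        simp only [indicator_apply, mem_ofPred_eq]
        split_ifs <;> simp [mul_comm]
    _ ≤ ENNReal.ofReal (4 * p' / (p' - 2)) * ∫⁻ x, (2 * A) ^ (p' - 2) * ‖u x‖ₑ ^ p := by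
        simp_rw [lintegral_indicator_rpow hp'2]
        refine mul_le_mul_right (lintegral_mono fun x => ?_) _
        exact rpow_mul_div_rpow_le hpp' hp' _ _ enorm_ne_top
    _ = _ := by
        rw [lintegral_const_mul _ (hm.enorm.pow_const _), hAdef, ENNReal.mul_rpow_of_nonneg _ _ hp'2.le,
          ENNReal.ofReal_mul hc, mul_assoc, mul_assoc, show p' - 1 = (p' - 2) + 1 by ring,
          ENNReal.rpow_add _ _ hA0 hA, ENNReal.rpow_one, ← ENNReal.ofReal_rpow_of_pos (by norm_num)]
        simp

/-- The Hausdorff-Young inequality, with some constant. -/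
theorem exists_eLpNorm_fourier_le {p p' : ℝ} (hp : 1 < p) (hp2 : p ≤ 2)
    (hpp' : 1 / p + 1 / p' = 1) :
    ∃ C : ℝ≥0, ∀ u : ℝ → ℂ, Integrable u → MemLp u (ENNReal.ofReal p) →
      eLpNorm (𝓕 u) (ENNReal.ofReal p') volume ≤ C * eLpNorm u (ENNReal.ofReal p) volume := by
  have hp'0 : p' ≠ 0 := by
    rintro rfl
    simp at hpp'
    linarith
  have hmul : p + p' = p * p' := by
    field_simp at hpp'
    linarith
  have hp'2 : 2 ≤ p' := by nlinarith
  -- The endpoint `p = 2` is Plancherel; it is treated apart because the interpolation constant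
  -- contains `1/(p' - 2)`.
  rcases hp2.eq_or_lt with rfl | hp2
  · have : p' = 2 := by linarith
    subst this
    refine ⟨1, fun u hu hu2 => ?_⟩
    have h2 : ENNReal.ofReal 2 = 2 := by norm_num
    rw [h2] at hu2 ⊢
    simpa using (eLpNorm_fourier_two hu hu2).le
  have hp'3 : 2 < p' := by nlinarith
  set C := ENNReal.ofReal (4 * p' / (p' - 2) * 2 ^ (p' - 2)) with hC
  refine ⟨(C ^ (1 / p')).toNNReal, fun u hu hup => ?_⟩
  have hCfin : C ^ (1 / p') ≠ ∞ := ENNReal.rpow_ne_top_of_nonneg (by positivity) (by simp [hC])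
  rw [ENNReal.coe_toNNReal hCfin]
  have hae := hup.1.ae_eq_mk
  set v := hup.1.mk u
  have hv : Measurable v := hup.1.stronglyMeasurable_mk.measurable
  rw [fourier_congr_ae hae, eLpNorm_congr_ae hae]
  replace hu := hu.congr hae
  replace hup := (memLp_congr_ae hae).1 hup
  have hptop : ENNReal.ofReal p ≠ 0 := by simp; linarith
  have hptop' : ENNReal.ofReal p' ≠ 0 := by simp; linarith
  have hA := (eLpNorm_lt_top_iff_lintegral_rpow_enorm_lt_top hptop (by simp)).1 hup.2
  rw [eLpNorm_eq_lintegral_rpow_enorm_toReal hptop' (by simp),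
    eLpNorm_eq_lintegral_rpow_enorm_toReal hptop (by simp)]
  rw [ENNReal.toReal_ofReal (by linarith)] at *
  rw [ENNReal.toReal_ofReal (by linarith)]
  by_cases hA0 : ∫⁻ x, ‖v x‖ₑ ^ p = 0
  · have h0 : v =ᵐ[volume] 0 := by
      rw [lintegral_eq_zero_iff (hv.enorm.pow_const _)] at hA0
      filter_upwards [hA0] with x hx
      simpa [ENNReal.rpow_eq_zero_iff, show 0 < p by linarith, show ¬ p < 0 by linarith] using hx
    rw [fourier_congr_ae h0]
    have : 𝓕 (0 : ℝ → ℂ) = 0 := by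
      funext ξ
      simp [Real.fourier_eq]
    simp [this, show 0 < p' by linarith]
  have := lintegral_fourier_rpow_le hp hmul hp'3 hv hu hA0 hA.ne
  refine (ENNReal.rpow_le_rpow this (by positivity)).trans (le_of_eq ?_)
  rw [ENNReal.mul_rpow_of_nonneg _ _ (by positivity), ← ENNReal.rpow_mul]
  congr 2
  field_simp
  linarith

end

section

/-! ### Laplace transforms as Poisson extensions -/

open scoped FourierTransform Real

/-- The Laplace transform of the restriction of `u` to `[0, τ]`. -/
noncomputable def laplace (τ : ℝ) (u : ℝ → ℂ) (z : ℂ) : ℂ :=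
  ∫ s in Icc 0 τ, Complex.exp (-z * s) * u s

lemma two_pi_mul_poissonKernel (t w : ℝ) :
    2 * π * poissonKernel t w = 2 * t / (t ^ 2 + w ^ 2) := by
  unfold poissonKernel
  have := Real.pi_ne_zero
  field_simp

lemma continuous_poissonKernel {t : ℝ} (ht : 0 < t) : Continuous (poissonKernel t) := by
  unfold poissonKernel
  refine continuous_const.div (by fun_prop) fun w => ?_
  positivity

lemma poissonKernel_nonneg {t : ℝ} (ht : 0 < t) (w : ℝ) : 0 ≤ poissonKernel t w := by
  unfold poissonKernel
  positivity

lemma integrable_poissonKernel {t : ℝ} (ht : 0 < t) : Integrable (poissonKernel t) := by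
  have h := (integrable_inv_one_add_sq.comp_mul_left' (inv_ne_zero ht.ne')).const_mul (π * t)⁻¹
  refine h.congr (Filter.Eventually.of_forall fun w => ?_)
  simp only [poissonKernel]
  field_simp

lemma integral_exp_neg_abs {a : ℂ} {t : ℝ} (ht : 0 < t) (ha : a.re = 0) :
    Integrable (fun s : ℝ => Complex.exp (a * s - t * |s|)) ∧
    ∫ s : ℝ, Complex.exp (a * s - t * |s|) = (t - a)⁻¹ + (t + a)⁻¹ := by
  have h1 : (a - t).re < 0 := by simpa [ha] using ht
  have h2 : 0 < (a + t).re := by simpa [ha] using ht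
  have e1 : EqOn (fun s : ℝ => Complex.exp (a * s - t * |s|)) (fun s : ℝ => Complex.exp ((a - t) * s))
      (Ioi 0) := by
    intro s hs
    simp only [abs_of_pos (show (0 : ℝ) < s from hs)]
    ring_nf
  have e2 : EqOn (fun s : ℝ => Complex.exp (a * s - t * |s|)) (fun s : ℝ => Complex.exp ((a + t) * s))
      (Iic 0) := by
    intro s hs
    simp only [abs_of_nonpos (show s ≤ 0 from hs)]
    push_cast
    ring_nf
  have i1 := (integrableOn_exp_mul_complex_Ioi h1 0).congr_fun e1.symm measurableSet_Ioi
  have i2 := (integrableOn_exp_mul_complex_Iic h2 0).congr_fun e2.symm measurableSet_Iic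
  refine ⟨?_, ?_⟩
  · rw [← integrableOn_univ, ← Iic_union_Ioi (a := (0 : ℝ))]
    exact i2.union i1
  · rw [← intervalIntegral.integral_Iic_add_Ioi i2 i1, setIntegral_congr_fun measurableSet_Ioi e1,
      setIntegral_congr_fun measurableSet_Iic e2, integral_exp_mul_complex_Ioi h1,
      integral_exp_mul_complex_Iic h2]
    simp only [Complex.ofReal_zero, mul_zero, Complex.exp_zero]
    rw [show a - t = -(t - a) by ring, neg_div_neg_eq, one_div, one_div, add_comm, add_comm a]

lemma fourierInv_exp_neg_abs {t : ℝ} (ht : 0 < t) (x ξ : ℝ) :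
    𝓕⁻ (fun s : ℝ => Complex.exp (-(x * Complex.I) * s - t * |s|)) ξ =
      ((2 * π * poissonKernel t (x - 2 * π * ξ) : ℝ) : ℂ) := by
  rw [Real.fourierInv_eq']
  have h := (integral_exp_neg_abs (a := (2 * π * ξ - x) * Complex.I) ht (by simp)).2
  rw [two_pi_mul_poissonKernel]
  calc _ = ∫ s : ℝ, Complex.exp ((2 * π * ξ - x) * Complex.I * s - t * |s|) := by
        congr 1
        funext s
        rw [smul_eq_mul, ← Complex.exp_add]
        congr 1
        simp
        ring
    _ = _ := by
        rw [h]
        have hne : (t : ℂ) ^ 2 + (x - 2 * π * ξ) ^ 2 ≠ 0 := by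
          have : t ^ 2 + (x - 2 * π * ξ) ^ 2 ≠ 0 := by positivity
          exact_mod_cast this
        have hfac : (t - (2 * π * ξ - x) * Complex.I) * (t + (2 * π * ξ - x) * Complex.I) =
            (t : ℂ) ^ 2 + (x - 2 * π * ξ) ^ 2 := by
          ring_nf
          simp [Complex.I_sq]
          ring
        have h1 : (t - (2 * π * ξ - x) * Complex.I) ≠ 0 := fun h0 => hne (by rw [← hfac, h0, zero_mul])
        have h2 : (t + (2 * π * ξ - x) * Complex.I) ≠ 0 := fun h0 => hne (by rw [← hfac, h0, mul_zero])
        push_cast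
        rw [eq_div_iff hne, ← hfac]
        field_simp
        ring

/-- Obtained by Fourier inversion: the inverse transform of the two-sided exponential is an
elementary integral over two half lines, and both functions are integrable. -/
lemma fourier_poissonKernel {t : ℝ} (ht : 0 < t) (x s : ℝ) :
    𝓕 (fun ξ : ℝ => ((2 * π * poissonKernel t (x - 2 * π * ξ) : ℝ) : ℂ)) s =
      Complex.exp (-(x * Complex.I) * s - t * |s|) := by
  have hint : Integrable fun ξ : ℝ => ((2 * π * poissonKernel t (x - 2 * π * ξ) : ℝ) : ℂ) := by
    have := ((integrable_poissonKernel ht).comp_sub_left x).comp_mul_left'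
      (mul_pos two_pos Real.pi_pos).ne'
    exact (this.const_mul (2 * π)).ofReal
  have heq : 𝓕⁻ (fun s : ℝ => Complex.exp (-(x * Complex.I) * s - t * |s|)) =
      fun ξ : ℝ => ((2 * π * poissonKernel t (x - 2 * π * ξ) : ℝ) : ℂ) :=
    funext (fourierInv_exp_neg_abs ht x)
  have hc : Continuous fun s : ℝ => Complex.exp (-(x * Complex.I) * s - t * |s|) := by fun_prop
  have := hc.fourier_fourierInv_eq (integral_exp_neg_abs (a := -(x * Complex.I)) ht (by simp)).1
    (hint.comp_neg.congr (Filter.Eventually.of_forall fun ξ =>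
      (congrFun heq (-ξ)).symm.trans (by rw [Real.fourierInv_eq_fourier_neg, neg_neg])))
  rw [heq] at this
  exact congrFun this s

/-- The Laplace transform is the Poisson extension of the (rescaled) Fourier transform. -/
lemma poissonExt_fourier {τ : ℝ} {u : ℝ → ℂ} (hu : IntegrableOn u (Icc 0 τ)) {z : ℂ}
    (hz : 0 < z.re) :
    poissonExt (fun y => 𝓕 ((Icc 0 τ).indicator u) ((2 * π)⁻¹ * y)) z = laplace τ u z := by
  have hpi : (0 : ℝ) < 2 * π := by positivity
  have hv : Integrable ((Icc 0 τ).indicator u) := (integrable_indicator_iff measurableSet_Icc).2 hu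
  set v := (Icc 0 τ).indicator u with hvdef
  have hG : Integrable fun ξ : ℝ => ((2 * π * poissonKernel z.re (z.im - 2 * π * ξ) : ℝ) : ℂ) := by
    have := ((integrable_poissonKernel hz).comp_sub_left z.im).comp_mul_left' hpi.ne'
    exact (this.const_mul (2 * π)).ofReal
  -- The multiplication formula moves the transform onto the Poisson kernel. The result `e^{-ixs -
  -- t|s|}` equals `e^{-zs}` for `s ≥ 0`, which is all that the support of `v` sees.
  have h2 := VectorFourier.integral_fourierIntegral_smul_eq_flip (L := innerₗ ℝ)
      Real.continuous_fourierChar continuous_inner hv hG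
  rw [flip_innerₗ] at h2
  have h3 : ∫ ξ, 𝓕 v ξ • ((2 * π * poissonKernel z.re (z.im - 2 * π * ξ) : ℝ) : ℂ) =
      ∫ s, v s • 𝓕 (fun ξ : ℝ => ((2 * π * poissonKernel z.re (z.im - 2 * π * ξ) : ℝ) : ℂ)) s := h2
  have h4 := Measure.integral_comp_mul_left (fun y : ℝ =>
    (poissonKernel z.re (z.im - y) : ℂ) * 𝓕 v ((2 * π)⁻¹ * y)) (2 * π)
  unfold poissonExt laplace
  calc _ = ((2 * π : ℝ) : ℂ) * ∫ ξ, (poissonKernel z.re (z.im - 2 * π * ξ) : ℂ) *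
          𝓕 v ((2 * π)⁻¹ * (2 * π * ξ)) := by
        rw [h4, Complex.real_smul, ← mul_assoc, abs_of_pos (inv_pos.2 hpi), ← Complex.ofReal_mul,
          mul_inv_cancel₀ hpi.ne', Complex.ofReal_one, one_mul]
    _ = ∫ ξ, 𝓕 v ξ • ((2 * π * poissonKernel z.re (z.im - 2 * π * ξ) : ℝ) : ℂ) := by
        rw [← integral_const_mul]
        congr 1
        funext ξ
        rw [inv_mul_cancel_left₀ hpi.ne', smul_eq_mul]
        push_cast
        ring
    _ = ∫ s, (Icc 0 τ).indicator (fun s : ℝ => Complex.exp (-z * s) * u s) s := by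
        rw [h3]
        congr 1
        funext s
        rw [fourier_poissonKernel hz, hvdef]
        by_cases hs : s ∈ Icc 0 τ
        · rw [indicator_of_mem hs, indicator_of_mem hs, abs_of_nonneg hs.1, smul_eq_mul, mul_comm]
          congr 2
          nth_rewrite 3 [← Complex.re_add_im z]
          ring
        · simp [hs]
    _ = _ := integral_indicator measurableSet_Icc

end

section

open scoped FourierTransform Real

/-! ### The Laplace-Carleson inequality -/

lemma lintegral_discreteMeasure {q : ℝ} {lam : ℕ → RightHalfPlane} {b : ℕ → ℂ} (g : ℂ → ℝ≥0∞) :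
    ∫⁻ z, g z ∂(discreteMeasure q lam b) = ∑' n, ENNReal.ofReal (‖b n‖ ^ q) * g (lam n) := by
  rw [discreteMeasure, lintegral_sum_measure]
  simp [lintegral_smul_measure, lintegral_dirac]

lemma eLpNorm_discreteMeasure {q : ℝ} (hq : 0 < q) {lam : ℕ → RightHalfPlane} {b : ℕ → ℂ}
    (F : ℂ → ℂ) :
    eLpNorm F (ENNReal.ofReal q) (discreteMeasure q lam b) =
      (∑' n, ‖b n * F (lam n)‖ₑ ^ q) ^ (1 / q) := by
  rw [eLpNorm_eq_lintegral_rpow_enorm_toReal (by simpa using hq) (by simp),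
    ENNReal.toReal_ofReal hq.le, lintegral_discreteMeasure]
  congr 2
  funext n
  rw [enorm_mul, ENNReal.mul_rpow_of_nonneg _ _ hq.le, ← ENNReal.ofReal_rpow_of_nonneg
    (norm_nonneg _) hq.le, ofReal_norm]

/-- The Laplace-Carleson inequality: `u ↦ 𝓛 u` is bounded from `L^p(0, ∞)` to `L^q(μ)`. -/
def LaplaceCarleson (p q : ℝ) (lam : ℕ → RightHalfPlane) (b : ℕ → ℂ) : Prop :=
  ∃ K : ℝ≥0, ∀ τ : ℝ, 0 < τ → ∀ u : ℝ → ℂ,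
    MemLp u (ENNReal.ofReal p) (volume.restrict (Icc 0 τ)) →
      eLpNorm (laplace τ u) (ENNReal.ofReal q) (discreteMeasure q lam b) ≤
        K * eLpNorm u (ENNReal.ofReal p) (volume.restrict (Icc 0 τ))

lemma integrableOn_of_memLp {p : ℝ} (hp : 1 ≤ p) {τ : ℝ} {u : ℝ → ℂ}
    (hu : MemLp u (ENNReal.ofReal p) (volume.restrict (Icc 0 τ))) : IntegrableOn u (Icc 0 τ) :=
  hu.integrable (ENNReal.one_le_ofReal.2 hp)

lemma eLpNorm_comp_mul_left {r c : ℝ} (hr : 0 < r) (hc : 0 < c) {f : ℝ → ℂ} (hf : Measurable f) :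
    eLpNorm (fun y => f (c * y)) (ENNReal.ofReal r) volume =
      ENNReal.ofReal c⁻¹ ^ (1 / r) * eLpNorm f (ENNReal.ofReal r) volume := by
  rw [eLpNorm_eq_lintegral_rpow_enorm_toReal (by simpa using hr) (by simp),
    eLpNorm_eq_lintegral_rpow_enorm_toReal (by simpa using hr) (by simp),
    ENNReal.toReal_ofReal hr.le, ← ENNReal.mul_rpow_of_nonneg _ _ (by positivity)]
  congr 1
  rw [← lintegral_map (f := fun y => ‖f y‖ₑ ^ r) (g := fun y => c * y)
    (hf.enorm.pow_const _) (by fun_prop), Real.map_volume_mul_left hc.ne',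
    lintegral_smul_measure, abs_of_pos (inv_pos.2 hc), smul_eq_mul]

theorem IsEmbeddingCarleson.laplaceCarleson {p p' q α : ℝ} (hp : 1 < p) (hp2 : p ≤ 2)
    (hpp' : 1 / p + 1 / p' = 1) (hp' : 0 < p') (hq : 1 < q) (hα : α * q = p')
    {lam : ℕ → RightHalfPlane} {b : ℕ → ℂ}
    (h : IsEmbeddingCarleson α q (discreteMeasure q lam b)) : LaplaceCarleson p q lam b := by
  obtain ⟨M, hM⟩ := h
  obtain ⟨C, hC⟩ := exists_eLpNorm_fourier_le hp hp2 hpp'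
  rw [hα] at hM
  set c : ℝ≥0∞ := ENNReal.ofReal ((2 * π)⁻¹)⁻¹ ^ (1 / p') with hc
  have hctop : c ≠ ∞ := ENNReal.rpow_ne_top_of_nonneg (by positivity) ENNReal.ofReal_ne_top
  refine ⟨M * (c.toNNReal * C), fun τ hτ u hu => ?_⟩
  have hui := integrableOn_of_memLp hp.le hu
  set v := (Icc 0 τ).indicator u with hv
  have hvi : Integrable v := (integrable_indicator_iff measurableSet_Icc).2 hui
  have hvp : MemLp v (ENNReal.ofReal p) := (memLp_indicator_iff_restrict measurableSet_Icc).2 hu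
  have hcont := continuous_fourier_of_integrable hvi
  set f : ℝ → ℂ := fun y => 𝓕 v ((2 * π)⁻¹ * y) with hf
  have hfn : eLpNorm f (ENNReal.ofReal p') volume ≤
      c * (C * eLpNorm u (ENNReal.ofReal p) (volume.restrict (Icc 0 τ))) := by
    rw [eLpNorm_comp_mul_left hp' (by positivity) hcont.measurable,
      ← eLpNorm_indicator_eq_eLpNorm_restrict measurableSet_Icc]
    gcongr
    exact hC v hvi hvp
  have hfmem : MemLp f (ENNReal.ofReal p') := by
    refine ⟨(hcont.comp (by fun_prop)).aestronglyMeasurable, hfn.trans_lt ?_⟩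
    exact ENNReal.mul_lt_top hctop.lt_top (ENNReal.mul_lt_top (by simp) hu.2)
  -- The two functions are identified only on the open half plane, which suffices because the
  -- measure is carried by the points `λ_n`.
  have heq : eLpNorm (laplace τ u) (ENNReal.ofReal q) (discreteMeasure q lam b) =
      eLpNorm (poissonExt f) (ENNReal.ofReal q) (discreteMeasure q lam b) := by
    simp_rw [eLpNorm_discreteMeasure (zero_lt_one.trans hq), ← poissonExt_fourier hui (lam _).2]
    rfl
  rw [heq]
  refine (hM f hfmem).trans ?_
  push_cast
  rw [ENNReal.coe_toNNReal hctop, mul_assoc, mul_assoc]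
  gcongr

end

/-! ### Geometric Carleson measures -/

lemma mem_tent_iff {O : Set ℝ} {z : ℂ} :
    z ∈ tent O ↔ 0 < z.re ∧ ∀ x ∉ O, z.re ≤ |x - z.im| := by
  simp only [tent, cone, mem_sdiff, mem_ofPred_eq, mem_iUnion, not_exists, mem_compl_iff]
  refine and_congr_right fun h => forall₂_congr fun x _ => ?_
  simp [h]

/-- Only the cones at the two endpoints matter, since a vertex farther out imposes a weaker
condition. The vertex `z.im` itself, were it outside the interval, would force `z.re ≤ 0`. -/
lemma mem_tent_Ioo {x y : ℝ} {z : ℂ} :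
    z ∈ tent (Ioo x y) ↔ 0 < z.re ∧ z.re ≤ z.im - x ∧ z.re ≤ y - z.im := by
  rw [mem_tent_iff]
  refine and_congr_right fun hz => ⟨fun h => ?_, fun ⟨h1, h2⟩ w hw => ?_⟩
  · have him : z.im ∈ Ioo x y := by
      by_contra hn
      have := h _ hn
      simp at this
      linarith
    have h1 := h x (by simp)
    have h2 := h y (by simp)
    rw [abs_of_neg (by linarith [him.1])] at h1
    rw [abs_of_pos (by linarith [him.2])] at h2
    constructor <;> linarith
  · rw [mem_Ioo, not_and_or, not_lt, not_lt] at hw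
    rcases hw with hw | hw
    · rw [abs_of_neg (by linarith)]
      linarith
    · rw [abs_of_pos (by linarith)]
      linarith

lemma measurableSet_tent_Ioo (x y : ℝ) : MeasurableSet (tent (Ioo x y)) := by
  have : tent (Ioo x y) = {z : ℂ | 0 < z.re} ∩ ({z | z.re ≤ z.im - x} ∩ {z | z.re ≤ y - z.im}) := by
    ext z
    exact mem_tent_Ioo
  rw [this]
  have hre := Complex.measurable_re
  have him := Complex.measurable_im
  exact (measurableSet_lt measurable_const hre).inter
    ((measurableSet_le hre (him.sub_const x)).inter (measurableSet_le hre (him.const_sub y)))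

lemma IsGeometricCarleson.exists_le {α : ℝ} (hα : 0 < α) {μ : Measure ℂ}
    (h : IsGeometricCarleson α μ) :
    ∃ c : ℝ≥0, ∀ x y : ℝ, x < y →
      μ (tent (Ioo x y)) ≤ (c * ENNReal.ofReal (y - x)) ^ (1 / α) := by
  obtain ⟨c, hc⟩ := h
  refine ⟨c, fun x y hxy => ?_⟩
  have := ENNReal.rpow_le_rpow (hc x y hxy) (show 0 ≤ 1 / α by positivity)
  rwa [← ENNReal.rpow_mul, mul_one_div_cancel hα.ne', ENNReal.rpow_one] at this

/-- Modulating to the midpoint leaves an exponent `w` with `‖w‖ ≤ |I|/2` on the tent. With `τ =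
1/(2|I|)` this gives `‖w s‖ ≤ 1/4`, so the integrand stays within `1/2` of `1` and the integral has
modulus at least `τ/2`. -/
lemma le_norm_laplace_exp {x y : ℝ} (hxy : x < y) {z : ℂ} (hz : z ∈ tent (Ioo x y)) :
    (4 * (y - x))⁻¹ ≤ ‖laplace (2 * (y - x))⁻¹
      (fun s => Complex.exp ((x + y) / 2 * Complex.I * s)) z‖ := by
  obtain ⟨h0, h1, h2⟩ := mem_tent_Ioo.1 hz
  set τ := (2 * (y - x))⁻¹ with hτ
  have hτ0 : 0 < τ := by
    have : 0 < y - x := by linarith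
    positivity
  set w : ℂ := -z + (x + y) / 2 * Complex.I with hw
  have hwn : ‖w‖ ≤ (y - x) / 2 := by
    refine (Complex.norm_le_abs_re_add_abs_im w).trans ?_
    have hre : w.re = -z.re := by simp [hw]
    have him : w.im = -z.im + (x + y) / 2 := by
      simp [hw]
    rw [hre, him, abs_neg, abs_of_pos h0]
    have : |-z.im + (x + y) / 2| ≤ (y - x) / 2 - z.re := abs_le.2 ⟨by linarith, by linarith⟩
    linarith
  have hlap : laplace τ (fun s => Complex.exp ((x + y) / 2 * Complex.I * s)) z =
      ∫ s in (0 : ℝ)..τ, Complex.exp (w * s) := by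
    rw [laplace, integral_Icc_eq_integral_Ioc, intervalIntegral.integral_of_le hτ0.le]
    congr 1
    funext s
    rw [← Complex.exp_add, hw]
    ring_nf
  have hdiff : ‖∫ s in (0 : ℝ)..τ, (Complex.exp (w * s) - 1)‖ ≤ 1 / 2 * |τ - 0| := by
    refine intervalIntegral.norm_integral_le_of_norm_le_const fun s hs => ?_
    rw [uIoc_of_le hτ0.le] at hs
    have hws : ‖w * s‖ ≤ 1 / 4 := by
      rw [norm_mul, Complex.norm_real, Real.norm_of_nonneg hs.1.le]
      calc ‖w‖ * s ≤ (y - x) / 2 * τ :=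
            mul_le_mul hwn hs.2 hs.1.le (by linarith)
        _ = 1 / 4 := by
            rw [hτ]
            have : y - x ≠ 0 := by linarith
            field_simp
            norm_num
    have := Complex.norm_exp_sub_one_le (x := w * s) (by linarith)
    linarith
  rw [intervalIntegral.integral_sub (by apply Continuous.intervalIntegrable; fun_prop) (by simp),
    sub_zero, abs_of_pos hτ0] at hdiff
  simp only [intervalIntegral.integral_const, sub_zero, Complex.real_smul, mul_one] at hdiff
  rw [hlap]
  have h3 : τ - ‖∫ s in (0 : ℝ)..τ, Complex.exp (w * s)‖ ≤ 1 / 2 * τ := by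
    refine le_trans ?_ hdiff
    rw [norm_sub_rev]
    have := norm_sub_norm_le (τ : ℂ) (∫ s in (0 : ℝ)..τ, Complex.exp (w * s))
    rwa [Complex.norm_real, Real.norm_of_nonneg hτ0.le] at this
  have h4 : (4 * (y - x))⁻¹ = 1 / 2 * τ := by
    rw [hτ]
    field_simp
    norm_num
  linarith

theorem LaplaceCarleson.isGeometricCarleson {p p' q α : ℝ} (hp : 1 < p)
    (hpp' : 1 / p + 1 / p' = 1) (hp' : 0 < p') (hq : 1 < q) (hα : α * q = p')
    {lam : ℕ → RightHalfPlane} {b : ℕ → ℂ} (h : LaplaceCarleson p q lam b) :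
    IsGeometricCarleson α (discreteMeasure q lam b) := by
  obtain ⟨K, hK⟩ := h
  have hq0 : 0 < q := by linarith
  have hp0 : 0 < p := by linarith
  -- From `(τ/2) μ(T(I))^{1/q} ≤ K τ^{1/p}` follows `μ(T(I))^{1/q} ≤ 2K τ^{-1/p'}`. Raising to the
  -- power `p' = αq` and inserting `τ^{-1} = 2|I|` gives this constant.
  refine ⟨(2 * K) ^ p' * 2, fun x y hxy => ?_⟩
  set μ := discreteMeasure q lam b
  set τ := (2 * (y - x))⁻¹ with hτ
  have hyx : 0 < y - x := by linarith
  have hτ0 : 0 < τ := by positivity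
  set u : ℝ → ℂ := fun s => Complex.exp ((x + y) / 2 * Complex.I * s) with hu
  have hun : ∀ s, ‖u s‖ = 1 := by
    intro s
    have : ((x : ℂ) + y) / 2 * Complex.I * s = (((x + y) / 2 * s : ℝ) : ℂ) * Complex.I := by
      push_cast
      ring
    rw [hu]
    simp only
    rw [this, Complex.norm_exp_ofReal_mul_I]
  have huN : eLpNorm u (ENNReal.ofReal p) (volume.restrict (Icc 0 τ)) =
      ENNReal.ofReal τ ^ (1 / p) := by
    rw [eLpNorm_congr_norm_ae (g := fun _ : ℝ => (1 : ℂ))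
      (Filter.Eventually.of_forall fun s => by simp [hun s]),
      eLpNorm_const' _ (by simpa using hp0) (by simp)]
    simp [hp0.le]
  have hum : MemLp u (ENNReal.ofReal p) (volume.restrict (Icc 0 τ)) := by
    refine ⟨(by fun_prop : Continuous u).aestronglyMeasurable, ?_⟩
    rw [huN]
    exact ENNReal.rpow_lt_top_of_nonneg (by positivity) (by simp)
  have h1 := hK τ hτ0 u hum
  rw [huN] at h1
  have h2 : ENNReal.ofReal (τ / 2) * μ (tent (Ioo x y)) ^ (1 / q) ≤
      eLpNorm (laplace τ u) (ENNReal.ofReal q) μ := by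
    rw [eLpNorm_eq_lintegral_rpow_enorm_toReal (by simpa using hq0) (by simp),
      ENNReal.toReal_ofReal hq0.le]
    have : ENNReal.ofReal (τ / 2) = (ENNReal.ofReal (τ / 2) ^ q) ^ (1 / q) := by
      rw [← ENNReal.rpow_mul, mul_one_div_cancel hq0.ne', ENNReal.rpow_one]
    rw [this, ← ENNReal.mul_rpow_of_nonneg _ _ (by positivity)]
    refine ENNReal.rpow_le_rpow ?_ (by positivity)
    rw [← setLIntegral_const]
    refine (setLIntegral_mono' (measurableSet_tent_Ioo x y) fun z hz => ?_).trans
      (setLIntegral_le_lintegral _ _)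
    refine ENNReal.rpow_le_rpow ?_ hq0.le
    rw [← ofReal_norm]
    refine ENNReal.ofReal_le_ofReal (le_trans (le_of_eq ?_) (le_norm_laplace_exp hxy hz))
    rw [hτ]
    field_simp
    norm_num
  have h3 : μ (tent (Ioo x y)) ^ (1 / q) ≤ 2 * K * ENNReal.ofReal τ ^ (-(1 / p')) := by
    have h4 := h2.trans h1
    have hτe : ENNReal.ofReal τ ≠ 0 := by simpa using hτ0
    have hτ2 : ENNReal.ofReal (τ / 2) = ENNReal.ofReal τ * 2⁻¹ := by
      rw [ENNReal.ofReal_div_of_pos two_pos, div_eq_mul_inv]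
      simp
    have : ENNReal.ofReal τ ^ (1 / p) = ENNReal.ofReal (τ / 2) * (2 * ENNReal.ofReal τ ^ (-(1 / p'))) := by
      rw [show 1 / p = 1 + -(1 / p') by linarith, ENNReal.rpow_add _ _ hτe (by simp),
        ENNReal.rpow_one, hτ2, mul_assoc, ← mul_assoc 2⁻¹, ENNReal.inv_mul_cancel (by simp) (by simp),
        one_mul]
    rw [this, mul_left_comm, ENNReal.mul_le_mul_iff_right (by simpa using hτ0) (by simp)] at h4
    refine h4.trans (le_of_eq ?_)
    ring
  have h5 := ENNReal.rpow_le_rpow h3 hp'.le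
  rw [← ENNReal.rpow_mul, ENNReal.mul_rpow_of_nonneg _ _ hp'.le, ← ENNReal.rpow_mul,
    show 1 / q * p' = α by rw [← hα]; field_simp, show -(1 / p') * p' = -1 by field_simp,
    ENNReal.rpow_neg_one, ← ENNReal.ofReal_inv_of_pos hτ0, hτ, inv_inv,
    ENNReal.ofReal_mul (by norm_num)] at h5
  refine h5.trans (le_of_eq ?_)
  push_cast
  rw [ENNReal.coe_rpow_of_nonneg _ hp'.le]
  simp [mul_assoc]

/-! ### Geometric Carleson measures and the spaces `X_{-θ}` -/

lemma memℓp_ofReal_iff {q : ℝ} (hq : 0 < q) (x : ℕ → ℂ) :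
    Memℓp x (ENNReal.ofReal q) ↔ ∑' n, ‖x n‖ₑ ^ q ≠ ∞ := by
  rw [memℓp_gen_iff (by rwa [ENNReal.toReal_ofReal hq.le]), ENNReal.toReal_ofReal hq.le]
  have : ∀ n, ‖x n‖ₑ ^ q = ((‖x n‖₊ ^ q : ℝ≥0) : ℝ≥0∞) := by
    intro n
    rw [ENNReal.coe_rpow_of_nonneg _ hq.le]
    rfl
  simp_rw [this]
  rw [ENNReal.tsum_coe_ne_top_iff_summable, ← NNReal.summable_coe]
  simp

/-- Where `|1 + z|` is of size `2^k`, the weight is about `2^{-kθq}` and the point lies in a tent of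
mass `O(2^{k/α})`. The resulting geometric series converges because `θq > 1/α`. -/
theorem IsGeometricCarleson.mem_extrapolation {q α θ : ℝ} (hα : 0 < α) (hq : 1 < q)
    (hθ : 1 / (α * q) < θ) {lam : ℕ → RightHalfPlane} {b : ℕ → ℂ}
    (h : IsGeometricCarleson α (discreteMeasure q lam b)) : b ∈ extrapolation q lam θ := by
  obtain ⟨c, hc⟩ := h.exists_le hα
  have hq0 : 0 < q := by linarith
  have hθ0 : 0 < θ := lt_trans (by positivity) hθ
  set μ := discreteMeasure q lam b
  change Memℓp _ _
  rw [memℓp_ofReal_iff hq0]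
  -- Both `z.re` and `|z.im|` are below `2^{k+1}`, and membership in the tent asks that their sum
  -- not exceed the half-length `2^{k+2}`.
  let T : ℕ → Set ℂ := fun k => tent (Ioo (-2 ^ (k + 2)) (2 ^ (k + 2)))
  let g : ℂ → ℝ≥0∞ := fun z => ∑' k, (T k).indicator
    (fun _ => ENNReal.ofReal ((2 ^ k : ℝ) ^ (-(θ * q)))) z
  have hterm : ∀ n, ‖b n / (1 + (lam n : ℂ)) ^ (θ : ℂ)‖ₑ ^ q ≤
      ENNReal.ofReal (‖b n‖ ^ q) * g (lam n) := by
    intro n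
    have hz : 0 < (lam n : ℂ).re := (lam n).2
    set z := (lam n : ℂ)
    have hre : 1 + z.re ≤ ‖1 + z‖ := by simpa using Complex.re_le_norm (1 + z)
    have him : |z.im| ≤ ‖1 + z‖ := by simpa using Complex.abs_im_le_norm (1 + z)
    obtain ⟨k, hk1, hk2⟩ := exists_nat_pow_near (x := ‖1 + z‖) (by linarith) one_lt_two
    have hT : z ∈ T k := by
      rw [mem_tent_Ioo]
      have := abs_le.1 him
      have h4 : (2 : ℝ) ^ (k + 2) = 2 ^ (k + 1) + 2 ^ (k + 1) := by ring
      refine ⟨hz, ?_, ?_⟩ <;> linarith [this.1, this.2]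
    have hpos : 0 < ‖1 + z‖ := by linarith
    refine le_trans ?_ (mul_le_mul_right (ENNReal.le_tsum k) _)
    rw [indicator_of_mem hT, ← ofReal_norm, norm_div, Complex.norm_cpow_real,
      ENNReal.ofReal_rpow_of_nonneg (by positivity) hq0.le, ← ENNReal.ofReal_mul (by positivity)]
    refine ENNReal.ofReal_le_ofReal ?_
    rw [Real.div_rpow (norm_nonneg _) (by positivity), ← Real.rpow_mul hpos.le, div_eq_mul_inv,
      ← Real.rpow_neg hpos.le]
    refine mul_le_mul_of_nonneg_left ?_ (by positivity)
    exact Real.rpow_le_rpow_of_nonpos (by positivity) hk1 (by nlinarith)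
  refine ne_top_of_le_ne_top ?_ (ENNReal.tsum_le_tsum hterm)
  rw [← lintegral_discreteMeasure, lintegral_tsum fun k =>
    (measurable_const.indicator (measurableSet_tent_Ioo _ _)).aemeasurable]
  simp_rw [lintegral_indicator_const (measurableSet_tent_Ioo _ _)]
  set ρ : ℝ := 2 ^ (1 / α - θ * q) with hρ
  have hρ1 : ρ < 1 := by
    refine Real.rpow_lt_one_of_one_lt_of_neg one_lt_two ?_
    have : 1 / α = 1 / (α * q) * q := by field_simp
    nlinarith
  have hle : ∀ k : ℕ, ENNReal.ofReal ((2 ^ k : ℝ) ^ (-(θ * q))) * μ (T k) ≤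
      (c * ENNReal.ofReal 8) ^ (1 / α) * ENNReal.ofReal ρ ^ k := by
    intro k
    have h2 : (0 : ℝ) < 2 ^ k := by positivity
    refine (mul_le_mul_right (hc _ _ (by linarith [pow_pos (two_pos (α := ℝ)) (k + 2)])) _).trans
      (le_of_eq ?_)
    rw [show (2 : ℝ) ^ (k + 2) - -2 ^ (k + 2) = 8 * 2 ^ k by ring, ENNReal.ofReal_mul (by norm_num),
      ← mul_assoc, ENNReal.mul_rpow_of_nonneg _ _ (by positivity), mul_left_comm,
      ENNReal.ofReal_rpow_of_pos h2, ← ENNReal.ofReal_mul (by positivity), ← Real.rpow_add h2,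
      ← ENNReal.ofReal_pow (by positivity)]
    congr 2
    rw [hρ, ← Real.rpow_natCast, ← Real.rpow_natCast, ← Real.rpow_mul (by norm_num),
      ← Real.rpow_mul (by norm_num)]
    ring_nf
  refine ne_top_of_le_ne_top ?_ (ENNReal.tsum_le_tsum hle)
  rw [ENNReal.tsum_mul_left, ENNReal.tsum_geometric]
  refine ENNReal.mul_ne_top (ENNReal.rpow_ne_top_of_nonneg (by positivity) (by finiteness)) ?_
  rw [ENNReal.inv_ne_top, ← ENNReal.ofReal_one, ← ENNReal.ofReal_sub _ (by positivity)]
  simpa using hρ1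

/-! ### Admissibility and the Laplace-Carleson inequality -/

lemma enorm_lp {q : ℝ} (hq : 0 < q) (x : lp (fun _ : ℕ => ℂ) (ENNReal.ofReal q)) :
    ENNReal.ofReal ‖x‖ = (∑' n, ‖x n‖ₑ ^ q) ^ (1 / q) := by
  have hsum := (memℓp_gen_iff (by rwa [ENNReal.toReal_ofReal hq.le])).1 x.2
  rw [lp.norm_eq_tsum_rpow (by rwa [ENNReal.toReal_ofReal hq.le])]
  rw [ENNReal.toReal_ofReal hq.le] at hsum ⊢
  rw [← ENNReal.ofReal_rpow_of_nonneg (tsum_nonneg fun n => by positivity) (by positivity),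
    ENNReal.ofReal_tsum_of_nonneg (fun n => by positivity) hsum]
  congr 2
  funext n
  rw [← ENNReal.ofReal_rpow_of_nonneg (norm_nonneg _) hq.le, ofReal_norm]

section Bochner

variable {q : ℝ} [Fact (1 ≤ ENNReal.ofReal q)]

lemma lp_norm_mono (hq : 0 < q) {x y : lp (fun _ : ℕ => ℂ) (ENNReal.ofReal q)}
    (h : ∀ n, ‖x n‖ ≤ ‖y n‖) : ‖x‖ ≤ ‖y‖ := by
  rw [← ENNReal.ofReal_le_ofReal_iff (norm_nonneg _), enorm_lp hq, enorm_lp hq]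
  refine ENNReal.rpow_le_rpow (ENNReal.tsum_le_tsum fun n => ?_) (by positivity)
  refine ENNReal.rpow_le_rpow ?_ hq.le
  rw [← ofReal_norm, ← ofReal_norm]
  exact ENNReal.ofReal_le_ofReal (h n)

variable {lam : ℕ → RightHalfPlane} {θ : ℝ}

lemma norm_semigroup_le (hq : 0 < q) (t : ℝ≥0) (ξ : ExtrapolationSpace q lam θ) :
    ‖semigroup t ξ‖ ≤ ‖ξ‖ := by
  refine lp_norm_mono hq fun n => ?_
  change ‖Complex.exp (-(lam n : ℂ) * (t : ℝ)) * ξ.toSeq n / (1 + (lam n : ℂ)) ^ (θ : ℂ)‖ ≤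
    ‖ξ.toSeq n / (1 + (lam n : ℂ)) ^ (θ : ℂ)‖
  rw [mul_div_assoc, norm_mul]
  refine mul_le_of_le_one_left (norm_nonneg _) ?_
  rw [Complex.norm_exp, Real.exp_le_one_iff]
  have := mul_nonneg (lam n).2.le t.2
  simpa using this

/-- The coordinate functionals of `X_{-θ}`. -/
noncomputable def coordCLM (q : ℝ) [Fact (1 ≤ ENNReal.ofReal q)] (lam : ℕ → RightHalfPlane) (θ : ℝ)
    (n : ℕ) : ExtrapolationSpace q lam θ →L[ℂ] ℂ :=
  ((1 + (lam n : ℂ)) ^ (θ : ℂ)) • (lp.evalCLM ℂ (fun _ : ℕ => ℂ) (ENNReal.ofReal q) n ∘L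
    (ExtrapolationSpace.isometryEquiv (q := q) (lam := lam) (θ := θ)).toContinuousLinearEquiv)

lemma coordCLM_apply (n : ℕ) (ξ : ExtrapolationSpace q lam θ) :
    coordCLM q lam θ n ξ = ξ.toSeq n :=
  mul_div_cancel₀ (ξ.toSeq n) (weight_ne_zero (lam n) θ)

/-- Finite truncations depend continuously on `s` and converge in norm because the exponent is
finite, so continuity of each coordinate is enough; norm continuity of the orbit is not needed. -/
lemma stronglyMeasurable_of_coord {f : ℝ → ExtrapolationSpace q lam θ}
    (h : ∀ n, Continuous fun s => (f s).toSeq n) : StronglyMeasurable f := by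
  set e := ExtrapolationSpace.isometryEquiv (q := q) (lam := lam) (θ := θ)
  have h1 : StronglyMeasurable fun s => e (f s) := by
    refine stronglyMeasurable_of_tendsto (u := Filter.atTop)
      (f := fun (N : ℕ) s => ∑ n ∈ Finset.range N, lp.single (ENNReal.ofReal q) n (e (f s) n)) ?_ ?_
    · intro N
      refine (continuous_finsetSum _ fun n _ => ?_).stronglyMeasurable
      refine (lp.isometry_single (E := fun _ : ℕ => ℂ) n).continuous.comp ?_
      change Continuous fun s => (f s).toSeq n / (1 + (lam n : ℂ)) ^ (θ : ℂ)
      exact (h n).div_const _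
    · rw [tendsto_pi_nhds]
      exact fun s => (lp.hasSum_single (by simp) (e (f s))).tendsto_sum_nat
  have h2 := e.symm.continuous.comp_stronglyMeasurable h1
  simpa using h2

/-- Coordinate functionals commute with the Bochner integral, whose integrability comes from
contractivity of the semigroup; the substitution `r = t - s` then produces the Laplace transform. -/
lemma toSeq_integral (hq : 0 < q) {b : ℕ → ℂ} (hb : b ∈ extrapolation q lam θ) {t : ℝ} (ht : 0 ≤ t)
    {u : ℝ → ℂ} (hu : IntegrableOn u (Icc 0 t)) (n : ℕ) :
    (∫ s in (0 : ℝ)..t, u s • semigroup (t - s).toNNReal (ExtrapolationSpace.mk b hb)).toSeq n =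
      b n * laplace t (fun s => u (t - s)) (lam n) := by
  have hsm : StronglyMeasurable fun s : ℝ =>
      semigroup (t - s).toNNReal (ExtrapolationSpace.mk b hb) := by
    refine stronglyMeasurable_of_coord fun n => ?_
    change Continuous fun s : ℝ => Complex.exp (-(lam n : ℂ) * ((t - s).toNNReal : ℝ)) * b n
    fun_prop
  have hu' : IntervalIntegrable u volume 0 t :=
    (intervalIntegrable_iff_integrableOn_Icc_of_le ht).2 hu
  have hint : IntervalIntegrable
      (fun s => u s • semigroup (t - s).toNNReal (ExtrapolationSpace.mk b hb)) volume 0 t := by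
    rw [intervalIntegrable_iff] at hu' ⊢
    refine (hu'.norm.mul_const ‖ExtrapolationSpace.mk b hb‖).mono'
      (hu'.aestronglyMeasurable.smul hsm.aestronglyMeasurable) ?_
    refine Filter.Eventually.of_forall fun s => ?_
    rw [norm_smul]
    exact mul_le_mul_of_nonneg_left (norm_semigroup_le hq _ _) (norm_nonneg _)
  rw [← coordCLM_apply, ← ContinuousLinearMap.intervalIntegral_comp_comm _ hint]
  have h1 : ∀ s ∈ uIcc 0 t,
      coordCLM q lam θ n (u s • semigroup (t - s).toNNReal (ExtrapolationSpace.mk b hb)) =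
      (fun r : ℝ => b n * (Complex.exp (-(lam n : ℂ) * r) * u (t - r))) (t - s) := by
    intro s hs
    rw [uIcc_of_le ht] at hs
    rw [map_smul, coordCLM_apply, smul_eq_mul]
    change u s * (Complex.exp (-(lam n : ℂ) * ((t - s).toNNReal : ℝ)) * b n) = _
    rw [Real.coe_toNNReal _ (by linarith [hs.2])]
    simp only [sub_sub_cancel]
    ring
  rw [intervalIntegral.integral_congr h1]
  refine (intervalIntegral.integral_comp_sub_left
    (fun r : ℝ => b n * (Complex.exp (-(lam n : ℂ) * r) * u (t - r))) t).trans ?_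
  rw [intervalIntegral.integral_const_mul, sub_self, sub_zero, laplace,
    integral_Icc_eq_integral_Ioc, intervalIntegral.integral_of_le ht]

end Bochner

lemma measurePreserving_reverse (τ : ℝ) :
    MeasurePreserving (fun s : ℝ => τ - s) (volume.restrict (Icc 0 τ))
      (volume.restrict (Icc 0 τ)) := by
  have := (Measure.measurePreserving_sub_left (volume : Measure ℝ) τ).restrict_preimage
    (measurableSet_Icc (a := 0) (b := τ))
  simpa using this

theorem IsAdmissible.laplaceCarleson {p q : ℝ} (hp : 1 < p) (hq : 1 < q)
    {lam : ℕ → RightHalfPlane} {b : ℕ → ℂ} (h : IsAdmissible p hq lam b) :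
    LaplaceCarleson p q lam b := by
  have : Fact (1 ≤ ENNReal.ofReal q) := ⟨ENNReal.one_le_ofReal.2 hq.le⟩
  have hq0 : 0 < q := by linarith
  obtain ⟨hb, K, hK⟩ := h
  refine ⟨K.toNNReal, fun τ hτ u hu => ?_⟩
  have hmp := measurePreserving_reverse τ
  have hv := hu.comp_measurePreserving hmp
  have hveq := eLpNorm_comp_measurePreserving (p := ENNReal.ofReal p) hu.1 hmp
  -- The reversed input is used at the final time `t = τ`, where the convolution reverses it back to
  -- `u`.
  obtain ⟨x, hx, hxn⟩ := hK τ hτ _ hv τ ⟨hτ.le, le_rfl⟩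
  rw [hveq] at hxn
  have hcoord : ∀ n, x n = b n * laplace τ u (lam n) := by
    intro n
    rw [hx, toSeq_integral hq0 hb hτ.le (integrableOn_of_memLp hp.le hv)]
    simp
  rw [eLpNorm_discreteMeasure hq0]
  simp_rw [← hcoord]
  rw [← enorm_lp hq0]
  refine (ENNReal.ofReal_le_ofReal hxn).trans ?_
  rw [ENNReal.ofReal_mul' ENNReal.toReal_nonneg, ENNReal.ofReal_toReal hu.2.ne]
  rfl

theorem LaplaceCarleson.isAdmissible {p q : ℝ} (hp : 1 < p) (hq : 1 < q)
    {lam : ℕ → RightHalfPlane} {b : ℕ → ℂ} (h : LaplaceCarleson p q lam b)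
    (hb : b ∈ extrapolation q lam 1) : IsAdmissible p hq lam b := by
  have : Fact (1 ≤ ENNReal.ofReal q) := ⟨ENNReal.one_le_ofReal.2 hq.le⟩
  have hq0 : 0 < q := by linarith
  obtain ⟨K, hK⟩ := h
  refine ⟨hb, K, fun τ hτ u hu t ht => ?_⟩
  have hsub : volume.restrict (Icc 0 t) ≤ volume.restrict (Icc 0 τ) :=
    Measure.restrict_mono (Icc_subset_Icc_right ht.2) le_rfl
  have hut := hu.mono_measure hsub
  have hmp := measurePreserving_reverse t
  have hv := hut.comp_measurePreserving hmp
  have hveq := eLpNorm_comp_measurePreserving (p := ENNReal.ofReal p) hut.1 hmp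
  -- The Laplace-Carleson inequality is applied on `[0, t]`, so a positive length is needed; at `t =
  -- 0` the integral vanishes.
  rcases ht.1.eq_or_lt with rfl | ht0
  · refine ⟨0, ?_, ?_⟩
    · funext n
      rw [toSeq_integral hq0 hb le_rfl (integrableOn_of_memLp hp.le hut)]
      simp [laplace]
    · rw [norm_zero]
      positivity
  have h1 := hK t ht0 _ hv
  rw [hveq, eLpNorm_discreteMeasure hq0] at h1
  replace h1 := h1.trans (mul_le_mul_right (eLpNorm_mono_measure u hsub) _)
  have hfin : (K : ℝ≥0∞) * eLpNorm u (ENNReal.ofReal p) (volume.restrict (Icc 0 τ)) ≠ ∞ :=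
    ENNReal.mul_ne_top ENNReal.coe_ne_top hu.2.ne
  have hmem : Memℓp (fun n => b n * laplace t (fun s => u (t - s)) (lam n)) (ENNReal.ofReal q) := by
    rw [memℓp_ofReal_iff hq0]
    intro htop
    rw [Function.comp_def] at h1
    rw [htop, ENNReal.top_rpow_of_pos (by positivity)] at h1
    exact hfin (top_le_iff.1 h1)
  refine ⟨⟨_, hmem⟩, ?_, ?_⟩
  · funext n
    rw [toSeq_integral hq0 hb ht0.le (integrableOn_of_memLp hp.le hut)]
  · rw [← ENNReal.ofReal_le_ofReal_iff (by positivity), enorm_lp hq0,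
      ENNReal.ofReal_mul K.coe_nonneg, ENNReal.ofReal_toReal hu.2.ne, ENNReal.ofReal_coe_nnreal]
    exact h1

section

/-! ### The Carleson embedding theorem -/

open scoped Real

/-- The Poisson extension of a non-negative function, as a Lebesgue integral. -/
noncomputable def poissonLintegral (f : ℝ → ℝ≥0∞) (z : ℂ) : ℝ≥0∞ :=
  ∫⁻ y, ENNReal.ofReal (poissonKernel z.re (z.im - y)) * f y

lemma measurable_poissonLintegral {f : ℝ → ℝ≥0∞} (hf : Measurable f) :
    Measurable (poissonLintegral f) := by
  refine Measurable.lintegral_prod_right' (f := fun w : ℂ × ℝ =>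
    ENNReal.ofReal (poissonKernel w.1.re (w.1.im - w.2)) * f w.2) ?_
  unfold poissonKernel
  fun_prop

/-- The truncation in `ENNReal.ofReal` kills the kernel for `z.re ≤ 0`, so level sets lie in the
half plane wherever `μ` lives. -/
lemma re_pos_of_poissonLintegral_pos {f : ℝ → ℝ≥0∞} {z : ℂ} (h : 0 < poissonLintegral f z) :
    0 < z.re := by
  by_contra! hz
  refine h.ne' ?_
  have : ∀ y, ENNReal.ofReal (poissonKernel z.re (z.im - y)) = 0 := fun y =>
    ENNReal.ofReal_of_nonpos (div_nonpos_of_nonpos_of_nonneg hz (by positivity))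
  simp [poissonLintegral, this]

lemma enorm_poissonExt_le (f : ℝ → ℂ) {z : ℂ} (hz : 0 < z.re) :
    ‖poissonExt f z‖ₑ ≤ poissonLintegral (fun y => ‖f y‖ₑ) z := by
  refine (enorm_integral_le_lintegral_enorm _).trans (le_of_eq (lintegral_congr fun y => ?_))
  rw [enorm_mul, ← ofReal_norm (_ : ℂ), Complex.norm_real,
    Real.norm_of_nonneg (poissonKernel_nonneg hz _)]

lemma lintegral_poissonKernel {t : ℝ} (ht : 0 < t) (x : ℝ) :
    ∫⁻ y, ENNReal.ofReal (poissonKernel t (x - y)) = 1 := by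
  rw [← ofReal_integral_eq_lintegral_ofReal ((integrable_poissonKernel ht).comp_sub_left x)
    (Filter.Eventually.of_forall fun y => poissonKernel_nonneg ht _),
    integral_sub_left_eq_self (poissonKernel t) volume x]
  have h : poissonKernel t = fun w => (π * t)⁻¹ * (1 + (t⁻¹ * w) ^ 2)⁻¹ := by
    funext w
    simp only [poissonKernel]
    field_simp
  rw [h, integral_const_mul, Measure.integral_comp_mul_left (fun w : ℝ => (1 + w ^ 2)⁻¹),
    integral_univ_inv_one_add_sq, inv_inv, abs_of_pos ht, smul_eq_mul]
  have := Real.pi_pos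
  rw [mul_comm π t, inv_mul_cancel₀ (by positivity), ENNReal.ofReal_one]

/-- The kernel is at most `t/r²` at distance at least `r`. A single dyadic shell already supplies
the bound, and the factor `4` pays for the ratio between its inner and outer radius. -/
lemma poissonKernel_le_tsum {t : ℝ} (ht : 0 < t) (x y : ℝ) :
    ENNReal.ofReal (poissonKernel t (x - y)) ≤
      ∑' k : ℕ, (Metric.closedBall x (2 ^ k * t)).indicator
        (fun _ => ENNReal.ofReal (4 / t * (1 / 4) ^ k)) y := by
  have hpi := Real.pi_gt_three
  have hk : ∃ k : ℕ, |x - y| ≤ 2 ^ k * t ∧ poissonKernel t (x - y) ≤ 4 / t * (1 / 4) ^ k := by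
    have hden : ∀ r : ℝ, 0 < r → r ≤ t ^ 2 + (x - y) ^ 2 → poissonKernel t (x - y) ≤ t / r := by
      intro r hr h
      refine div_le_div_of_nonneg_left ht.le hr (h.trans ?_)
      nlinarith [sq_nonneg t, sq_nonneg (x - y)]
    by_cases h0 : |x - y| ≤ t
    · refine ⟨0, by simpa using h0, (hden (t ^ 2) (by positivity) (by nlinarith)).trans ?_⟩
      rw [pow_zero, mul_one, sq, div_mul_cancel_left₀ ht.ne', inv_eq_one_div]
      gcongr
      norm_num
    · push Not at h0
      obtain ⟨k, hk1, hk2⟩ := exists_nat_pow_near (x := |x - y| / t) (y := 2)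
        ((one_le_div ht).2 h0.le) one_lt_two
      rw [le_div_iff₀ ht] at hk1
      rw [div_lt_iff₀ ht] at hk2
      refine ⟨k + 1, hk2.le, (hden ((2 ^ k * t) ^ 2) (by positivity) ?_).trans (le_of_eq ?_)⟩
      · rw [← sq_abs (x - y)]
        have : (2 ^ k * t) ^ 2 ≤ |x - y| ^ 2 := by gcongr
        nlinarith
      · have h4 : (1 / 4 : ℝ) ^ (k + 1) * 4 = ((2 ^ k) ^ 2)⁻¹ := by
          rw [← pow_mul, mul_comm k 2, pow_mul, ← inv_pow, pow_succ]
          norm_num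
          ring
        rw [mul_pow, show 4 / t * (1 / 4) ^ (k + 1) = (1 / 4) ^ (k + 1) * 4 / t by ring, h4]
        field_simp
  obtain ⟨k, hk1, hk2⟩ := hk
  refine le_trans ?_ (ENNReal.le_tsum k)
  rw [indicator_of_mem]
  · exact ENNReal.ofReal_le_ofReal hk2
  · rw [Metric.mem_closedBall, dist_comm, Real.dist_eq]
    exact hk1

/-- The Poisson extension is controlled by averages over intervals centred at `z.im` of radius at
least `z.re`. If every such average were small, the `k`-th dyadic shell would contribute at most
`(s/2) 2^{-k}`, with total only `s`. -/
lemma exists_radius {f : ℝ → ℝ≥0∞} (hf : Measurable f) {z : ℂ} {s : ℝ} (hs : 0 < s)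
    (h : ENNReal.ofReal s < poissonLintegral f z) :
    ∃ R, z.re ≤ R ∧ ENNReal.ofReal (s * R) ≤ 8 * ∫⁻ y in Metric.closedBall z.im R, f y := by
  have hz : 0 < z.re := re_pos_of_poissonLintegral_pos (zero_le.trans_lt h)
  by_contra! hcon
  refine absurd h (not_lt.2 ?_)
  set t := z.re
  have hk : ∀ k : ℕ, ENNReal.ofReal (4 / t * (1 / 4) ^ k) *
      ∫⁻ y in Metric.closedBall z.im (2 ^ k * t), f y ≤ ENNReal.ofReal (s / 2) * 2⁻¹ ^ k := by
    intro k
    have h1 : t ≤ 2 ^ k * t := le_mul_of_one_le_left hz.le (one_le_pow₀ one_le_two)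
    have h2 := (hcon _ h1).le
    calc ENNReal.ofReal (4 / t * (1 / 4) ^ k) * ∫⁻ y in Metric.closedBall z.im (2 ^ k * t), f y
        = ENNReal.ofReal (1 / (2 * t) * (1 / 4) ^ k) *
          (8 * ∫⁻ y in Metric.closedBall z.im (2 ^ k * t), f y) := by
          rw [← mul_assoc]
          congr 1
          rw [show (8 : ℝ≥0∞) = ENNReal.ofReal 8 by norm_num, ← ENNReal.ofReal_mul (by positivity)]
          congr 1
          field_simp
          norm_num
      _ ≤ ENNReal.ofReal (1 / (2 * t) * (1 / 4) ^ k) * ENNReal.ofReal (s * (2 ^ k * t)) := by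
          gcongr
      _ = _ := by
          rw [← ENNReal.ofReal_mul (by positivity),
            show (2⁻¹ : ℝ≥0∞) = ENNReal.ofReal 2⁻¹ by
              rw [ENNReal.ofReal_inv_of_pos two_pos]; norm_num,
            ← ENNReal.ofReal_pow (by norm_num), ← ENNReal.ofReal_mul (by positivity)]
          congr 1
          have : (1 / 4 : ℝ) ^ k * 2 ^ k = 2⁻¹ ^ k := by
            rw [← mul_pow]
            norm_num
          rw [← this]
          field_simp
  calc poissonLintegral f z
      ≤ ∫⁻ y, ∑' k : ℕ, (Metric.closedBall z.im (2 ^ k * t)).indicator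
          (fun y => ENNReal.ofReal (4 / t * (1 / 4) ^ k) * f y) y := by
        refine lintegral_mono fun y => ?_
        refine (mul_le_mul_left (poissonKernel_le_tsum hz _ _) _).trans ?_
        rw [← ENNReal.tsum_mul_right]
        refine le_of_eq (tsum_congr fun k => ?_)
        by_cases hy : y ∈ Metric.closedBall z.im (2 ^ k * t)
        · rw [indicator_of_mem hy, indicator_of_mem hy]
        · rw [indicator_of_notMem hy, indicator_of_notMem hy, zero_mul]
    _ = ∑' k : ℕ, ENNReal.ofReal (4 / t * (1 / 4) ^ k) *
          ∫⁻ y in Metric.closedBall z.im (2 ^ k * t), f y := by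
        rw [lintegral_tsum fun k =>
          ((hf.const_mul _).indicator Metric.isClosed_closedBall.measurableSet).aemeasurable]
        refine tsum_congr fun k => ?_
        rw [lintegral_indicator Metric.isClosed_closedBall.measurableSet, lintegral_const_mul _ hf]
    _ ≤ ∑' k : ℕ, ENNReal.ofReal (s / 2) * 2⁻¹ ^ k := ENNReal.tsum_le_tsum hk
    _ = ENNReal.ofReal s := by
        rw [ENNReal.tsum_mul_left, ENNReal.tsum_geometric, ENNReal.one_sub_inv_two, inv_inv,
          show (2 : ℝ≥0∞) = ENNReal.ofReal 2 by norm_num, ← ENNReal.ofReal_mul (by positivity)]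
        congr 1
        ring

/-- Superadditivity of `x ↦ x^a`. In the covering argument below this is the step that needs `a =
1/α ≥ 1`. -/
lemma tsum_rpow_le_rpow_tsum {ι : Type*} (x : ι → ℝ≥0∞) {a : ℝ} (ha : 1 ≤ a) :
    ∑' i, x i ^ a ≤ (∑' i, x i) ^ a := by
  rw [ENNReal.tsum_eq_iSup_sum]
  refine iSup_le fun S => ?_
  refine le_trans ?_ (ENNReal.rpow_le_rpow (ENNReal.sum_le_tsum S) (by linarith))
  classical
  induction S using Finset.induction_on with
  | empty => simp
  | insert i S hi ih =>
    rw [Finset.sum_insert hi, Finset.sum_insert hi]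
    exact (add_le_add_right ih _).trans (ENNReal.add_rpow_le_rpow_add _ _ ha)

lemma mem_tent_of_closedBall_subset {z : ℂ} {v R r : ℝ} (hz : 0 < z.re) (hR : z.re ≤ R)
    (hr : 0 < r) (h : Metric.closedBall z.im R ⊆ Metric.closedBall v (4 * r)) :
    z ∈ tent (Ioo (v - 5 * r) (v + 5 * r)) := by
  rw [Real.closedBall_eq_Icc, Real.closedBall_eq_Icc,
    Icc_subset_Icc_iff (by linarith)] at h
  rw [mem_tent_Ioo]
  refine ⟨hz, ?_, ?_⟩ <;> linarith [h.1, h.2]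

/-- Each point of the level set gets an interval that carries mass of `f` proportional to `s` times
its length. The tents over the five-fold enlargements of a disjoint Vitali subfamily cover the level
set, and disjointness bounds the sum of the masses by `∫ f`. The factor `80` is `10` (length of an
enlarged interval over `R`) times `8` from `exists_radius`. -/
lemma measure_lt_poissonLintegral_le {μ : Measure ℂ} {c : ℝ≥0} {a : ℝ} (ha : 1 ≤ a)
    (hμ : ∀ x y : ℝ, x < y → μ (tent (Ioo x y)) ≤ (c * ENNReal.ofReal (y - x)) ^ a)
    {f : ℝ → ℝ≥0∞} (hf : Measurable f) (hfi : ∫⁻ y, f y ≠ ∞) {s : ℝ} (hs : 0 < s) :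
    μ {z | ENNReal.ofReal s < poissonLintegral f z} ≤
      (80 * c * ENNReal.ofReal s⁻¹ * ∫⁻ y, f y) ^ a := by
  set E := {z | ENNReal.ofReal s < poissonLintegral f z}
  choose! R hR1 hR2 using fun z (hz : z ∈ E) => exists_radius hf hs hz
  have hre : ∀ z ∈ E, 0 < z.re := fun z hz =>
    re_pos_of_poissonLintegral_pos (zero_le.trans_lt hz)
  have hR3 : ∀ z ∈ E, ENNReal.ofReal (R z) ≤
      8 * ENNReal.ofReal s⁻¹ * ∫⁻ y in Metric.closedBall z.im (R z), f y := by
    intro z hz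
    have := mul_le_mul_right (hR2 z hz) (ENNReal.ofReal s⁻¹)
    rw [← ENNReal.ofReal_mul (by positivity), inv_mul_cancel_left₀ hs.ne'] at this
    refine this.trans (le_of_eq ?_)
    ring
  have hbdd : ∀ z ∈ E, R z ≤ (8 * ENNReal.ofReal s⁻¹ * ∫⁻ y, f y).toReal := by
    intro z hz
    refine (ENNReal.ofReal_le_iff_le_toReal (by finiteness)).1 ((hR3 z hz).trans ?_)
    gcongr
    exact Measure.restrict_le_self
  -- Vitali selection needs bounded radii, provided by integrability of `f`, and an enlargement
  -- factor above `3`.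
  obtain ⟨S, hSE, hSd, hScov⟩ := Vitali.exists_disjoint_subfamily_covering_enlargement_closedBall
    E Complex.im R _ hbdd 4 (by norm_num)
  have hRpos : ∀ z ∈ E, 0 < R z := fun z hz => (hre z hz).trans_le (hR1 z hz)
  have hSc : S.Countable := by
    refine hSd.countable_of_nonempty_interior fun z hz => ?_
    rw [interior_closedBall _ (hRpos z (hSE hz)).ne']
    exact Metric.nonempty_ball.2 (hRpos z (hSE hz))
  have hcov : E ⊆ ⋃ z ∈ S, tent (Ioo (z.im - 5 * R z) (z.im + 5 * R z)) := by
    intro z hz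
    obtain ⟨w, hw, hsub⟩ := hScov z hz
    exact mem_biUnion hw (mem_tent_of_closedBall_subset (hre z hz) (hR1 z hz)
      (hRpos w (hSE hw)) hsub)
  have : Countable S := hSc.to_subtype
  calc μ E ≤ ∑' z : S, μ (tent (Ioo ((z : ℂ).im - 5 * R z) ((z : ℂ).im + 5 * R z))) :=
        (measure_mono hcov).trans (measure_biUnion_le μ hSc _)
    _ ≤ ∑' z : S, (80 * c * ENNReal.ofReal s⁻¹ *
          ∫⁻ y in Metric.closedBall (z : ℂ).im (R z), f y) ^ a := by
        refine ENNReal.tsum_le_tsum fun z => ?_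
        have hz := hSE z.2
        refine (hμ _ _ (by linarith [hRpos z hz])).trans ?_
        refine ENNReal.rpow_le_rpow ?_ (by linarith)
        rw [show (z : ℂ).im + 5 * R z - ((z : ℂ).im - 5 * R z) = 10 * R z by ring,
          ENNReal.ofReal_mul (by norm_num)]
        calc (c : ℝ≥0∞) * (ENNReal.ofReal 10 * ENNReal.ofReal (R z))
            ≤ c * (ENNReal.ofReal 10 * (8 * ENNReal.ofReal s⁻¹ *
                ∫⁻ y in Metric.closedBall (z : ℂ).im (R z), f y)) := by
              gcongr
              exact hR3 z hz
          _ = _ := by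
              rw [show ENNReal.ofReal 10 = 10 by norm_num]
              ring
    _ ≤ (∑' z : S, 80 * c * ENNReal.ofReal s⁻¹ *
          ∫⁻ y in Metric.closedBall (z : ℂ).im (R z), f y) ^ a := tsum_rpow_le_rpow_tsum _ ha
    _ ≤ _ := by
        refine ENNReal.rpow_le_rpow ?_ (by linarith)
        rw [ENNReal.tsum_mul_left, ← lintegral_iUnion
          (fun z : S => Metric.isClosed_closedBall.measurableSet) (hSd.subtype _ _)]
        gcongr
        exact Measure.restrict_le_self

end

/-! ### Marcinkiewicz interpolation and the embedding -/

/-- The `L^∞` endpoint: the part of `f` not exceeding `s/2` contributes at most `s/2`, since the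
Poisson kernel has integral one. -/
lemma poissonLintegral_le_add {f : ℝ → ℝ≥0∞} (hf : Measurable f) {s : ℝ} {z : ℂ}
    (hz : 0 < z.re) :
    poissonLintegral f z ≤ poissonLintegral ({y | ENNReal.ofReal s < 2 * f y}.indicator f) z +
      ENNReal.ofReal (s / 2) := by
  have hk : Measurable fun y => ENNReal.ofReal (poissonKernel z.re (z.im - y)) :=
    ((continuous_poissonKernel hz).measurable.comp (measurable_const.sub measurable_id)).ennreal_ofReal
  have hE : MeasurableSet {y | ENNReal.ofReal s < 2 * f y} :=
    measurableSet_lt measurable_const (hf.const_mul _)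
  calc poissonLintegral f z
      ≤ ∫⁻ y, (ENNReal.ofReal (poissonKernel z.re (z.im - y)) *
          {y | ENNReal.ofReal s < 2 * f y}.indicator f y +
          ENNReal.ofReal (poissonKernel z.re (z.im - y)) * ENNReal.ofReal (s / 2)) := by
        refine lintegral_mono fun y => ?_
        simp only
        rw [← mul_add]
        gcongr
        by_cases hy : y ∈ {y | ENNReal.ofReal s < 2 * f y}
        · rw [indicator_of_mem hy]
          exact le_self_add
        · rw [indicator_of_notMem hy, zero_add, ENNReal.ofReal_div_of_pos two_pos,
            ENNReal.le_div_iff_mul_le (by simp) (by simp), mul_comm]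
          simpa using hy
    _ = _ := by
        have hm : Measurable fun y => ENNReal.ofReal (poissonKernel z.re (z.im - y)) *
          {y | ENNReal.ofReal s < 2 * f y}.indicator f y := hk.mul (hf.indicator hE)
        rw [lintegral_add_left hm, lintegral_mul_const _ hk,
          lintegral_poissonKernel hz, one_mul]
        rfl

lemma lintegral_truncation_le {f : ℝ → ℝ≥0∞} {r : ℝ} (hr : 1 < r) (hftop : ∀ y, f y ≠ ∞)
    {s : ℝ} (hs : 0 < s) :
    ∫⁻ y, {y | ENNReal.ofReal s < 2 * f y}.indicator f y ≤
      ENNReal.ofReal (s / 2) ^ (1 - r) * ∫⁻ y, f y ^ r := by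
  rw [← lintegral_const_mul' _ _ (by
    rw [ENNReal.ofReal_rpow_of_pos (by positivity)]; exact ENNReal.ofReal_ne_top)]
  refine lintegral_mono fun y => ?_
  by_cases hy : y ∈ {y | ENNReal.ofReal s < 2 * f y}
  · rw [indicator_of_mem hy]
    have hy' : ENNReal.ofReal (s / 2) < f y := by
      rw [ENNReal.ofReal_div_of_pos two_pos]
      refine ENNReal.div_lt_of_lt_mul' ?_
      simpa using hy
    have h0 : f y ≠ 0 := (zero_le.trans_lt hy').ne'
    calc f y = f y ^ (1 - r) * f y ^ r := by
          rw [← ENNReal.rpow_add _ _ h0 (hftop y), sub_add_cancel, ENNReal.rpow_one]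
      _ ≤ _ := by
          gcongr ?_ * _
          rw [show 1 - r = -(r - 1) by ring, ENNReal.rpow_neg, ENNReal.rpow_neg, ENNReal.inv_le_inv]
          exact ENNReal.rpow_le_rpow hy'.le (by linarith)
  · rw [indicator_of_notMem hy]
    exact zero_le

/-- Marcinkiewicz interpolation between the weak type `(1, a)` bound and the trivial bound on
`L^∞` for the Poisson extension. -/
lemma lintegral_poissonLintegral_rpow_le {μ : Measure ℂ} [SFinite μ] {c : ℝ≥0} {a r : ℝ}
    (ha : 1 ≤ a) (hr : 1 < r)
    (hμ : ∀ x y : ℝ, x < y → μ (tent (Ioo x y)) ≤ (c * ENNReal.ofReal (y - x)) ^ a)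
    {f : ℝ → ℝ≥0∞} (hf : Measurable f) (hftop : ∀ y, f y ≠ ∞) (hfr : ∫⁻ y, f y ^ r ≠ ∞) :
    ∫⁻ z, poissonLintegral f z ^ (r * a) ∂μ ≤
      ((160 * c) ^ a * ENNReal.ofReal (r * a / (r - 1) * 2 ^ ((r - 1) * a))) *
        (∫⁻ y, f y ^ r) ^ a := by
  obtain ⟨A, hA⟩ : ∃ A, ∫⁻ y, f y ^ r = A := ⟨_, rfl⟩
  rw [hA] at hfr ⊢
  have ha0 : 0 < a := by linarith
  have hq : 0 < r * a := by positivity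
  have hr1 : 0 < r - 1 := by linarith
  let E : ℝ → Set ℝ := fun s => {y | ENNReal.ofReal s < 2 * f y}
  have hE : ∀ s, MeasurableSet (E s) := fun s => measurableSet_lt measurable_const (hf.const_mul _)
  -- The weak type bound yields `J^a`, where `J` is the integral of the truncated function. Fubini
  -- needs `J` to the first power, so the factor `J^{a-1}` is bounded through `J ≤ (s/2)^{1-r} A`.
  have hlevel : ∀ s, 0 < s → μ {z | ENNReal.ofReal s < poissonLintegral f z} ≤
      (160 * c) ^ a * ENNReal.ofReal (s ^ (r - 1 - r * a) * 2 ^ ((r - 1) * (a - 1))) *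
        A ^ (a - 1) * ∫⁻ y, (E s).indicator f y := by
    intro s hs
    obtain ⟨J, hJ⟩ : ∃ J, ∫⁻ y, (E s).indicator f y = J := ⟨_, rfl⟩
    have hJA : J ≤ ENNReal.ofReal (s / 2) ^ (1 - r) * A := by
      rw [← hJ, ← hA]
      exact lintegral_truncation_le hr hftop hs
    have hJtop : J ≠ ∞ := by
      refine ne_top_of_le_ne_top (ENNReal.mul_ne_top ?_ hfr) hJA
      rw [ENNReal.ofReal_rpow_of_pos (by positivity)]
      exact ENNReal.ofReal_ne_top
    have hsub : {z | ENNReal.ofReal s < poissonLintegral f z} ⊆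
        {z | ENNReal.ofReal (s / 2) < poissonLintegral ((E s).indicator f) z} := by
      intro z hz
      have hz' : ENNReal.ofReal s < poissonLintegral f z := hz
      have h1 := hz'.trans_le (poissonLintegral_le_add (s := s) hf
        (re_pos_of_poissonLintegral_pos (zero_le.trans_lt hz')))
      have h2 : ENNReal.ofReal s = ENNReal.ofReal (s / 2) + ENNReal.ofReal (s / 2) := by
        rw [← ENNReal.ofReal_add (by positivity) (by positivity), add_halves]
      have h3 : ENNReal.ofReal (s / 2) + ENNReal.ofReal (s / 2) <
          poissonLintegral ((E s).indicator f) z + ENNReal.ofReal (s / 2) := by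
        rw [← h2]
        exact h1
      exact lt_of_add_lt_add_right h3
    have hw := measure_lt_poissonLintegral_le ha hμ (hf.indicator (hE s))
      (by rw [hJ]; exact hJtop) (half_pos hs)
    rw [hJ] at hw ⊢
    refine (measure_mono hsub).trans (hw.trans ?_)
    rcases eq_or_ne J 0 with h0 | h0
    · simp [h0, ha0]
    have h160 : 80 * (c : ℝ≥0∞) * ENNReal.ofReal (s / 2)⁻¹ = 160 * c * ENNReal.ofReal s⁻¹ := by
      rw [inv_div, div_eq_mul_inv, ENNReal.ofReal_mul two_pos.le, ENNReal.ofReal_ofNat]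
      ring
    rw [h160, mul_assoc (160 * (c : ℝ≥0∞)), ENNReal.mul_rpow_of_nonneg (160 * (c : ℝ≥0∞)) _ ha0.le,
      ENNReal.mul_rpow_of_nonneg _ J ha0.le, mul_assoc, mul_assoc]
    refine mul_le_mul_right ?_ _
    calc ENNReal.ofReal s⁻¹ ^ a * J ^ a = ENNReal.ofReal s⁻¹ ^ a * (J ^ (a - 1) * J) := by
          congr 1
          nth_rewrite 3 [← ENNReal.rpow_one J]
          rw [← ENNReal.rpow_add _ _ h0 hJtop, sub_add_cancel]
      _ ≤ ENNReal.ofReal s⁻¹ ^ a * ((ENNReal.ofReal (s / 2) ^ (1 - r) * A) ^ (a - 1) * J) := by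
          gcongr
      _ = _ := by
          rw [ENNReal.mul_rpow_of_nonneg _ A (by linarith), mul_assoc, ← mul_assoc]
          congr 1
          rw [ENNReal.ofReal_rpow_of_pos (by positivity), ENNReal.ofReal_rpow_of_pos (by positivity),
            ENNReal.ofReal_rpow_of_pos (by positivity), ← ENNReal.ofReal_mul (by positivity)]
          congr 1
          rw [← Real.rpow_mul (by positivity), Real.div_rpow hs.le two_pos.le, Real.inv_rpow hs.le,
            ← Real.rpow_neg hs.le, div_eq_mul_inv, ← Real.rpow_neg two_pos.le, ← mul_assoc,
            ← Real.rpow_add hs]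
          ring_nf
  have hjm : Measurable fun w : ℝ × ℝ => {w : ℝ × ℝ | ENNReal.ofReal w.1 < 2 * f w.2}.indicator
      (fun w => ENNReal.ofReal ((r - 1) * w.1 ^ (r - 1 - 1)) * f w.2) w := by
    refine Measurable.indicator (by fun_prop) (measurableSet_lt (by fun_prop) (by fun_prop))
  set C : ℝ≥0∞ := (160 * c) ^ a *
    ENNReal.ofReal (r * a / (r - 1) * 2 ^ ((r - 1) * (a - 1))) * A ^ (a - 1) with hC
  have hCtop : C ≠ ∞ := by
    refine ENNReal.mul_ne_top (ENNReal.mul_ne_top ?_ ENNReal.ofReal_ne_top) ?_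
    · exact ENNReal.rpow_ne_top_of_nonneg ha0.le (by finiteness)
    · exact ENNReal.rpow_ne_top_of_nonneg (by linarith) hfr
  calc ∫⁻ z, poissonLintegral f z ^ (r * a) ∂μ
      = ∫⁻ s in Ioi (0 : ℝ), ENNReal.ofReal (r * a * s ^ (r * a - 1)) *
          μ {z | ENNReal.ofReal s < poissonLintegral f z} :=
        lintegral_rpow_eq_lintegral_meas_lt (measurable_poissonLintegral hf) hq
    _ ≤ ∫⁻ s in Ioi (0 : ℝ), C * ∫⁻ y, {w : ℝ × ℝ | ENNReal.ofReal w.1 < 2 * f w.2}.indicator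
          (fun w => ENNReal.ofReal ((r - 1) * w.1 ^ (r - 1 - 1)) * f w.2) (s, y) := by
        refine setLIntegral_mono' measurableSet_Ioi fun s hs => ?_
        have hs : 0 < s := hs
        refine (mul_le_mul_right (hlevel s hs) _).trans (le_of_eq ?_)
        have hy : ∀ y, {w : ℝ × ℝ | ENNReal.ofReal w.1 < 2 * f w.2}.indicator
            (fun w => ENNReal.ofReal ((r - 1) * w.1 ^ (r - 1 - 1)) * f w.2) (s, y) =
            ENNReal.ofReal ((r - 1) * s ^ (r - 1 - 1)) * (E s).indicator f y := by
          intro y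
          by_cases hy : y ∈ E s
          · have hy' : (s, y) ∈ {w : ℝ × ℝ | ENNReal.ofReal w.1 < 2 * f w.2} := hy
            rw [indicator_of_mem hy, indicator_of_mem hy']
          · have hy' : (s, y) ∉ {w : ℝ × ℝ | ENNReal.ofReal w.1 < 2 * f w.2} := hy
            rw [indicator_of_notMem hy, indicator_of_notMem hy', mul_zero]
        simp_rw [hy]
        have hcoef : ENNReal.ofReal (r * a * s ^ (r * a - 1)) *
            ENNReal.ofReal (s ^ (r - 1 - r * a) * 2 ^ ((r - 1) * (a - 1))) =
            ENNReal.ofReal (r * a / (r - 1) * 2 ^ ((r - 1) * (a - 1))) *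
              ENNReal.ofReal ((r - 1) * s ^ (r - 1 - 1)) := by
          rw [← ENNReal.ofReal_mul (by positivity), ← ENNReal.ofReal_mul (by positivity)]
          congr 1
          rw [show r - 1 - 1 = (r * a - 1) + (r - 1 - r * a) by ring, Real.rpow_add hs]
          field_simp
        rw [lintegral_const_mul _ (hf.indicator (hE s)), hC]
        have key : ∀ X Y U V K T I : ℝ≥0∞, X * Y = U * V →
            X * (K * Y * T * I) = K * U * T * (V * I) := by
          intro X Y U V K T I h
          calc X * (K * Y * T * I) = X * Y * (K * T * I) := by ring
            _ = K * U * T * (V * I) := by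
              rw [h]
              ring
        exact key _ _ _ _ _ _ _ hcoef
    _ = C * ∫⁻ y, f y * ∫⁻ s in Ioi (0 : ℝ), {s | ENNReal.ofReal s < 2 * f y}.indicator
          (fun s => ENNReal.ofReal ((r - 1) * s ^ (r - 1 - 1))) s := by
        rw [lintegral_const_mul' _ _ hCtop, lintegral_lintegral_swap hjm.aemeasurable]
        congr 1
        refine lintegral_congr fun y => ?_
        rw [← lintegral_const_mul' _ _ (hftop y)]
        refine lintegral_congr fun s => ?_
        simp only [indicator_apply, mem_ofPred_eq]
        split_ifs <;> simp [mul_comm]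
    _ = C * (ENNReal.ofReal (2 ^ (r - 1)) * A) := by
        simp_rw [lintegral_indicator_rpow hr1]
        rw [← hA, ← lintegral_const_mul' _ _ ENNReal.ofReal_ne_top]
        congr 1
        refine lintegral_congr fun y => ?_
        rw [ENNReal.mul_rpow_of_nonneg _ _ hr1.le, ← ENNReal.ofReal_rpow_of_pos two_pos,
          ENNReal.ofReal_ofNat, mul_left_comm]
        congr 1
        rcases eq_or_ne (f y) 0 with h0 | h0
        · simp [h0, show 0 < r by linarith]
        nth_rewrite 1 [← ENNReal.rpow_one (f y)]
        rw [← ENNReal.rpow_add _ _ h0 (hftop y), add_sub_cancel]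
    _ = _ := by
        rcases eq_or_ne A 0 with h0 | h0
        · simp [h0, ha0]
        have hAa : A ^ a = A ^ (a - 1) * A := by
          nth_rewrite 3 [← ENNReal.rpow_one A]
          rw [← ENNReal.rpow_add _ _ h0 hfr, sub_add_cancel]
        have h2 : r * a / (r - 1) * 2 ^ ((r - 1) * a) =
            r * a / (r - 1) * 2 ^ ((r - 1) * (a - 1)) * 2 ^ (r - 1) := by
          rw [mul_assoc, ← Real.rpow_add two_pos]
          ring_nf
        rw [hAa, h2, ENNReal.ofReal_mul (by positivity), hC]
        ring

instance sFinite_discreteMeasure (q : ℝ) (lam : ℕ → RightHalfPlane) (b : ℕ → ℂ) :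
    SFinite (discreteMeasure q lam b) := by
  unfold discreteMeasure
  infer_instance

/-- The Carleson embedding theorem (due to Carleson for `α = 1` and Duren for `α < 1`). -/
theorem IsGeometricCarleson.isEmbeddingCarleson {q α : ℝ} (hα : 0 < α) (hα1 : α ≤ 1)
    (hq : 1 < q) (hr : 1 < α * q) {lam : ℕ → RightHalfPlane} {b : ℕ → ℂ}
    (h : IsGeometricCarleson α (discreteMeasure q lam b)) :
    IsEmbeddingCarleson α q (discreteMeasure q lam b) := by
  obtain ⟨c, hc⟩ := h.exists_le hα
  have hq0 : 0 < q := by linarith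
  set r := α * q with hrdef
  set a := 1 / α with hadef
  have hr0 : 0 < r := by linarith
  have ha : 1 ≤ a := (one_le_div hα).2 hα1
  have hra : r * a = q := by
    rw [hrdef, hadef]
    field_simp
  set C : ℝ≥0∞ := (160 * c) ^ a * ENNReal.ofReal (r * a / (r - 1) * 2 ^ ((r - 1) * a)) with hC
  have hCtop : C ^ (1 / q) ≠ ∞ := by
    refine ENNReal.rpow_ne_top_of_nonneg (by positivity)
      (ENNReal.mul_ne_top ?_ ENNReal.ofReal_ne_top)
    exact ENNReal.rpow_ne_top_of_nonneg (by linarith) (by finiteness)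
  refine ⟨(C ^ (1 / q)).toNNReal, fun f hf => ?_⟩
  rw [ENNReal.coe_toNNReal hCtop]
  have hae := hf.1.ae_eq_mk
  set g := hf.1.mk f
  have hg : Measurable g := hf.1.stronglyMeasurable_mk.measurable
  have hfg : poissonExt f = poissonExt g := by
    funext z
    exact integral_congr_ae (hae.mono fun y hy => by simp only [hy])
  rw [hfg, eLpNorm_congr_ae hae]
  replace hf := (memLp_congr_ae hae).1 hf
  have hfin := (eLpNorm_lt_top_iff_lintegral_rpow_enorm_lt_top (by simpa using hr0)
    (by simp)).1 hf.2
  rw [ENNReal.toReal_ofReal hr0.le] at hfin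
  have hmain := lintegral_poissonLintegral_rpow_le ha hr hc hg.enorm
    (fun y => enorm_ne_top) hfin.ne
  rw [hra, ← hra, ← hC, hra] at hmain
  rw [eLpNorm_discreteMeasure hq0, eLpNorm_eq_lintegral_rpow_enorm_toReal (by simpa using hr0)
    (by simp), ENNReal.toReal_ofReal hr0.le]
  have hle : ∑' n, ‖b n * poissonExt g (lam n)‖ₑ ^ q ≤
      ∫⁻ z, poissonLintegral (fun y => ‖g y‖ₑ) z ^ q ∂(discreteMeasure q lam b) := by
    rw [lintegral_discreteMeasure]
    refine ENNReal.tsum_le_tsum fun n => ?_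
    rw [enorm_mul, ENNReal.mul_rpow_of_nonneg _ _ hq0.le, ← ENNReal.ofReal_rpow_of_nonneg
      (norm_nonneg _) hq0.le, ofReal_norm]
    gcongr
    exact enorm_poissonExt_le g (lam n).2
  refine (ENNReal.rpow_le_rpow (hle.trans hmain) (by positivity)).trans (le_of_eq ?_)
  rw [ENNReal.mul_rpow_of_nonneg _ _ (by positivity), ← ENNReal.rpow_mul]
  congr 2
  rw [← hra]
  field_simp

/-! ### A Hardy type inequality for Laplace transforms at the points `2 ^ n` -/

/-- For `a ≤ 1` the integrand `x^{a-1} e^{-x}` decreases, so each summand with `y = 2^n s` is at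
most twice the integral over `(y/2, y]`. These intervals are disjoint, so the bound is a Gamma
integral independent of `s`. -/
lemma tsum_rpow_mul_exp_le {a s : ℝ} (ha1 : a ≤ 1) (hs : 0 < s) :
    ∑' n : ℕ, ENNReal.ofReal ((2 ^ n * s) ^ a * Real.exp (-(2 ^ n * s))) ≤
      2 * ∫⁻ x in Ioi (0 : ℝ), ENNReal.ofReal (x ^ (a - 1) * Real.exp (-x)) := by
  let g : ℕ → ℝ := fun n => 2 ^ n * (s / 2)
  have hg : Monotone g := fun m n h => by
    simp only [g]
    gcongr
    norm_num
  have hterm : ∀ n : ℕ, ENNReal.ofReal ((2 ^ n * s) ^ a * Real.exp (-(2 ^ n * s))) ≤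
      2 * ∫⁻ x in Ioc (g n) (g (n + 1)), ENNReal.ofReal (x ^ (a - 1) * Real.exp (-x)) := by
    intro n
    have hy : 0 < 2 ^ n * s := by positivity
    have hg1 : g (n + 1) = 2 ^ n * s := by
      simp only [g]
      ring
    have hg0 : g n = 2 ^ n * s / 2 := by
      simp only [g]
      ring
    rw [hg1, hg0]
    set y := 2 ^ n * s
    calc ENNReal.ofReal (y ^ a * Real.exp (-y))
        = 2 * (ENNReal.ofReal (y ^ (a - 1) * Real.exp (-y)) * volume (Ioc (y / 2) y)) := by
          rw [Real.volume_Ioc, ← ENNReal.ofReal_mul (by positivity),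
            show (2 : ℝ≥0∞) = ENNReal.ofReal 2 by norm_num, ← ENNReal.ofReal_mul (by positivity),
            Real.rpow_sub_one hy.ne']
          congr 1
          field_simp
          ring
      _ ≤ _ := by
          rw [← setLIntegral_const]
          refine mul_le_mul_right (setLIntegral_mono' measurableSet_Ioc fun x hx => ?_) _
          have hx0 : 0 < x := lt_trans (by positivity) hx.1
          refine ENNReal.ofReal_le_ofReal (mul_le_mul ?_ ?_ (by positivity) (by positivity))
          · exact Real.rpow_le_rpow_of_nonpos hx0 hx.2 (by linarith)
          · exact Real.exp_le_exp.2 (by linarith [hx.2])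
  refine (ENNReal.tsum_le_tsum hterm).trans ?_
  have hdisj : Pairwise (Function.onFun Disjoint fun n => Ioc (g n) (g (n + 1))) :=
    hg.pairwise_disjoint_on_Ioc_succ
  rw [ENNReal.tsum_mul_left, ← lintegral_iUnion (fun n => measurableSet_Ioc) hdisj]
  refine mul_le_mul_right (lintegral_mono_set (iUnion_subset fun n x hx => ?_)) _
  exact lt_trans (show 0 < g n by positivity) hx.1

/-- A Schur test: Hölder with the extra weights `s^{±1/(2p')}`. Without them the later sum over `x =
2^n` would involve `∑ e^{-2^n s}`, which is unbounded as `s → 0`; the gained power of `s` repairs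
this. -/
lemma enorm_laplace_rpow_le {p p' : ℝ} (hpp : p.HolderConjugate p') {τ : ℝ} {u : ℝ → ℂ}
    (hu : AEMeasurable u (volume.restrict (Ioc 0 τ))) {x : ℝ} (hx : 0 < x) :
    ‖laplace τ u x‖ₑ ^ p ≤ ENNReal.ofReal (((1 / x) ^ (1 / 2 : ℝ) * Real.Gamma (1 / 2)) ^ (p / p')) *
      ∫⁻ s in Ioc 0 τ, ‖u s‖ₑ ^ p * ENNReal.ofReal (s ^ (p / (2 * p')) * Real.exp (-(x * s))) := by
  have hp := hpp.pos
  have hp' := hpp.symm.pos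
  have hm : Measurable fun s : ℝ => ENNReal.ofReal (s ^ (1 / (2 * p')) * Real.exp (-(x * s) / p)) := by
    fun_prop
  have hm' : Measurable fun s : ℝ => ENNReal.ofReal (s ^ (-(1 / (2 * p'))) * Real.exp (-(x * s) / p')) := by
    fun_prop
  have h1 : ‖laplace τ u x‖ₑ ≤ ∫⁻ s in Ioc 0 τ, ((fun s => ‖u s‖ₑ *
      ENNReal.ofReal (s ^ (1 / (2 * p')) * Real.exp (-(x * s) / p))) *
      (fun s => ENNReal.ofReal (s ^ (-(1 / (2 * p'))) * Real.exp (-(x * s) / p')))) s := by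
    rw [laplace, integral_Icc_eq_integral_Ioc]
    refine (enorm_integral_le_lintegral_enorm _).trans (le_of_eq ?_)
    refine setLIntegral_congr_fun measurableSet_Ioc fun s hs => ?_
    have hs0 : 0 < s := hs.1
    simp only [Pi.mul_apply]
    rw [mul_assoc, ← ENNReal.ofReal_mul (by positivity), enorm_mul, mul_comm, ← ofReal_norm (Complex.exp _),
      Complex.norm_exp]
    congr 2
    rw [mul_mul_mul_comm, ← Real.rpow_add hs0, ← Real.exp_add, add_neg_cancel, Real.rpow_zero,
      one_mul]
    congr 1
    have := hpp.inv_add_inv_eq_one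
    calc _ = -(x * s) := by simp
      _ = -(x * s) * (p⁻¹ + p'⁻¹) := by rw [this, mul_one]
      _ = _ := by ring
  have h2 := h1.trans (ENNReal.lintegral_mul_le_Lp_mul_Lq (volume.restrict (Ioc 0 τ)) hpp
    (hu.enorm.mul hm.aemeasurable) hm'.aemeasurable)
  have h3 := ENNReal.rpow_le_rpow h2 hp.le
  rw [ENNReal.mul_rpow_of_nonneg _ _ hp.le, ← ENNReal.rpow_mul, ← ENNReal.rpow_mul,
    one_div_mul_cancel hp.ne', ENNReal.rpow_one, mul_comm] at h3
  refine h3.trans (mul_le_mul' ?_ (le_of_eq ?_))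
  · rw [show 1 / p' * p = p / p' by ring, ← ENNReal.ofReal_rpow_of_nonneg (by positivity) (by positivity)]
    refine ENNReal.rpow_le_rpow ?_ (by positivity)
    have hint : IntegrableOn (fun s : ℝ => s ^ (1 / 2 - 1 : ℝ) * Real.exp (-(x * s))) (Ioi 0) := by
      have := integrableOn_rpow_mul_exp_neg_mul_rpow (s := 1 / 2 - 1) (p := 1) (by norm_num) one_pos hx
      simpa using this
    rw [← Real.integral_rpow_mul_exp_neg_mul_Ioi (by norm_num) hx,
      ofReal_integral_eq_lintegral_ofReal hint ((ae_restrict_mem measurableSet_Ioi).mono fun s hs =>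
        mul_nonneg (Real.rpow_nonneg (le_of_lt hs) _) (Real.exp_nonneg _))]
    refine (lintegral_mono_set Ioc_subset_Ioi_self).trans (le_of_eq ?_)
    refine setLIntegral_congr_fun measurableSet_Ioi fun s hs => ?_
    have hs0 : 0 < s := hs
    rw [ENNReal.ofReal_rpow_of_nonneg (by positivity) hp'.le, Real.mul_rpow (by positivity)
      (by positivity), ← Real.rpow_mul hs0.le, ← Real.exp_mul]
    congr 3
    · field_simp
      norm_num
    · field_simp
  · refine setLIntegral_congr_fun measurableSet_Ioc fun s hs => ?_
    have hs0 : 0 < s := hs.1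
    rw [ENNReal.mul_rpow_of_nonneg _ _ hp.le, ENNReal.ofReal_rpow_of_nonneg (by positivity) hp.le,
      Real.mul_rpow (by positivity) (by positivity), ← Real.rpow_mul hs0.le, ← Real.exp_mul]
    congr 3
    · field_simp
    · field_simp

/-- This is the gain behind the counterexample: on the real dyadic points, Laplace transforms of
`L^p` functions are `ℓ_p`-summable after scaling, better than the `ℓ_{p'}` behaviour of general
Poisson extensions from `L^{p'}`. -/
lemma exists_tsum_laplace_two_pow_le {p p' : ℝ} (hp2 : p ≤ 2) (hpp : p.HolderConjugate p') :
    ∃ C : ℝ≥0∞, C ≠ ∞ ∧ ∀ (τ : ℝ) (u : ℝ → ℂ), AEMeasurable u (volume.restrict (Icc 0 τ)) →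
      ∑' n : ℕ, (ENNReal.ofReal ((2 ^ n) ^ (1 / p')) * ‖laplace τ u ((2 ^ n : ℝ) : ℂ)‖ₑ) ^ p ≤
        C * ∫⁻ s in Icc 0 τ, ‖u s‖ₑ ^ p := by
  have hp := hpp.pos
  have hp' := hpp.symm.pos
  set a := p / (2 * p') with ha
  have ha0 : 0 < a := by positivity
  have ha1 : a ≤ 1 := by
    have h := hpp.sub_one_mul_conj
    rw [ha, div_le_one (by positivity)]
    nlinarith [hpp.symm.lt]
  set D := ∫⁻ x in Ioi (0 : ℝ), ENNReal.ofReal (x ^ (a - 1) * Real.exp (-x)) with hD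
  have hDtop : D ≠ ∞ := by
    have hint := integrableOn_rpow_mul_exp_neg_mul_rpow (s := a - 1) (p := 1) (b := 1)
      (by linarith) one_pos one_pos
    have h := hint.lintegral_lt_top.ne
    simpa [hD] using h
  set G := ENNReal.ofReal (Real.Gamma (1 / 2) ^ (p / p')) with hG
  refine ⟨G * (2 * D), by finiteness, fun τ u hu => ?_⟩
  rw [← restrict_Ioc_eq_restrict_Icc] at hu ⊢
  have hterm : ∀ n : ℕ, (ENNReal.ofReal ((2 ^ n) ^ (1 / p')) * ‖laplace τ u ((2 ^ n : ℝ) : ℂ)‖ₑ) ^ p ≤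
      G * ∫⁻ s in Ioc 0 τ, ‖u s‖ₑ ^ p *
        ENNReal.ofReal ((2 ^ n * s) ^ a * Real.exp (-(2 ^ n * s))) := by
    intro n
    have h2 : (0 : ℝ) < 2 ^ n := by positivity
    rw [ENNReal.mul_rpow_of_nonneg _ _ hp.le, ENNReal.ofReal_rpow_of_nonneg (by positivity) hp.le]
    refine (mul_le_mul_right (enorm_laplace_rpow_le hpp hu h2) _).trans (le_of_eq ?_)
    rw [← mul_assoc, ← ENNReal.ofReal_mul (by positivity)]
    -- The exponents of `2^n` add up to `p/p' - p/(2p') = a`, matching the weight `s^a`.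
    have hc : ((2 ^ n : ℝ) ^ (1 / p')) ^ p *
        ((1 / 2 ^ n) ^ (1 / 2 : ℝ) * Real.Gamma (1 / 2)) ^ (p / p') =
        Real.Gamma (1 / 2) ^ (p / p') * (2 ^ n : ℝ) ^ a := by
      have hΓ : 0 ≤ Real.Gamma (1 / 2) := (Real.Gamma_pos_of_pos (by norm_num)).le
      rw [Real.mul_rpow (by positivity) hΓ, one_div (2 ^ n : ℝ), Real.inv_rpow h2.le,
        ← Real.rpow_neg h2.le, ← Real.rpow_mul h2.le, ← Real.rpow_mul h2.le, ← mul_assoc,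
        ← Real.rpow_add h2, mul_comm]
      congr 2
      rw [ha]
      field_simp
      norm_num
    rw [hc, ENNReal.ofReal_mul (by
      exact Real.rpow_nonneg (Real.Gamma_pos_of_pos (by norm_num)).le _), mul_assoc, hG,
      ← lintegral_const_mul' _ _ ENNReal.ofReal_ne_top]
    congr 1
    refine setLIntegral_congr_fun measurableSet_Ioc fun s hs => ?_
    rw [mul_left_comm, ← ENNReal.ofReal_mul (by positivity), ← mul_assoc (_ ^ a),
      ← Real.mul_rpow h2.le hs.1.le]
  refine (ENNReal.tsum_le_tsum hterm).trans ?_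
  rw [ENNReal.tsum_mul_left, mul_assoc]
  refine mul_le_mul_right ?_ _
  have hmeas : ∀ n : ℕ, AEMeasurable (fun s => ‖u s‖ₑ ^ p *
      ENNReal.ofReal ((2 ^ n * s) ^ a * Real.exp (-(2 ^ n * s)))) (volume.restrict (Ioc 0 τ)) :=
    fun n => (hu.enorm.pow_const _).mul (by fun_prop)
  rw [← lintegral_tsum hmeas, ← lintegral_const_mul' _ _ (by finiteness)]
  refine setLIntegral_mono' measurableSet_Ioc fun s hs => ?_
  rw [ENNReal.tsum_mul_left, mul_comm]
  exact mul_le_mul_left (tsum_rpow_mul_exp_le ha1 hs.1) _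

section

/-! ### An admissible input element without the embedding property -/

open scoped Real

lemma tsum_ofReal_rpow_ne_top {σ : ℝ} (hσ : 1 < σ) :
    ∑' n : ℕ, ENNReal.ofReal (((n : ℝ) + 1) ^ (-σ)) ≠ ∞ := by
  have h : Summable fun n : ℕ => ((n : ℝ) + 1) ^ (-σ) := by
    have := (summable_nat_add_iff 1).2 (Real.summable_nat_rpow.2 (show -σ < -1 by linarith))
    simpa using this
  rw [← ENNReal.ofReal_tsum_of_nonneg (fun n => by positivity) h]
  exact ENNReal.ofReal_ne_top

lemma tsum_ofReal_rpow_neg_one : ∑' n : ℕ, ENNReal.ofReal (((n : ℝ) + 1) ^ (-1 : ℝ)) = ∞ := by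
  by_contra hne
  have h := ENNReal.summable_toReal hne
  have h2 : Summable fun n : ℕ => (((n + 1 : ℕ) : ℝ)) ^ (-1 : ℝ) := by
    refine h.congr fun n => ?_
    rw [ENNReal.toReal_ofReal (by positivity)]
    push_cast
    rfl
  have h3 := Real.summable_nat_rpow.1
    ((summable_nat_add_iff (f := fun n : ℕ => (n : ℝ) ^ (-1 : ℝ)) 1).1 h2)
  linarith

lemma tsum_mul_le_Lp_mul_Lq {s t : ℝ} (h : s.HolderConjugate t) (x y : ℕ → ℝ≥0∞) :
    ∑' n, x n * y n ≤ (∑' n, x n ^ s) ^ (1 / s) * (∑' n, y n ^ t) ^ (1 / t) := by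
  have := ENNReal.lintegral_mul_le_Lp_mul_Lq (Measure.count : Measure ℕ) h
    (f := x) (g := y) (measurable_of_countable _).aemeasurable (measurable_of_countable _).aemeasurable
  simpa [lintegral_count] using this

/-- The sequence `(n + 1)^{-δ}` multiplies `ℓ_p` into `ℓ_q`. -/
lemma exists_tsum_multiplier_le {p q δ : ℝ} (hp : 0 < p) (hq : 0 < q) (hδ0 : 0 ≤ δ)
    (hδ : 1 / q - 1 / p < δ) :
    ∃ D : ℝ≥0∞, D ≠ ∞ ∧ ∀ v : ℕ → ℝ≥0∞,
      ∑' n : ℕ, (ENNReal.ofReal (((n : ℝ) + 1) ^ (-δ)) * v n) ^ q ≤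
        D * (∑' n, v n ^ p) ^ (q / p) := by
  rcases le_or_gt p q with hpq | hpq
  · refine ⟨1, by simp, fun v => ?_⟩
    rw [one_mul]
    refine le_trans (ENNReal.tsum_le_tsum fun n => ?_)
      (tsum_rpow_le_rpow_tsum (fun n => v n ^ p) ((one_le_div hp).2 hpq))
    rw [← ENNReal.rpow_mul, mul_div_cancel₀ _ hp.ne']
    refine ENNReal.rpow_le_rpow ?_ hq.le
    refine mul_le_of_le_one_left zero_le ?_
    rw [ENNReal.ofReal_le_one]
    exact Real.rpow_le_one_of_one_le_of_nonpos (by linarith [n.cast_nonneg (α := ℝ)]) (by linarith)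
  · have hc : (p / q).HolderConjugate (p / (p - q)) := by
      rw [Real.holderConjugate_iff]
      refine ⟨(one_lt_div hq).2 hpq, ?_⟩
      have : p - q ≠ 0 := by linarith
      field_simp
      ring
    have hpq' : 0 < p - q := by linarith
    -- For `q < p`, Hölder with exponents `p/q` and `p/(p-q)` needs this power of the multiplier to
    -- be summable, which is the condition `δ > 1/q - 1/p`.
    have hσ : 1 < δ * q * (p / (p - q)) := by
      rw [← mul_div_assoc, one_lt_div hpq']
      have : (1 / q - 1 / p) * (q * p) < δ * (q * p) :=
        mul_lt_mul_of_pos_right hδ (by positivity)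
      have h2 : (1 / q - 1 / p) * (q * p) = p - q := by field_simp
      linarith
    refine ⟨(∑' n : ℕ, ENNReal.ofReal (((n : ℝ) + 1) ^ (-(δ * q * (p / (p - q)))))) ^
      (1 / (p / (p - q))), ENNReal.rpow_ne_top_of_nonneg (by positivity)
      (tsum_ofReal_rpow_ne_top hσ), fun v => ?_⟩
    have := tsum_mul_le_Lp_mul_Lq hc (fun n => v n ^ q)
      (fun n => ENNReal.ofReal (((n : ℝ) + 1) ^ (-δ)) ^ q)
    calc ∑' n : ℕ, (ENNReal.ofReal (((n : ℝ) + 1) ^ (-δ)) * v n) ^ q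
        = ∑' n : ℕ, v n ^ q * ENNReal.ofReal (((n : ℝ) + 1) ^ (-δ)) ^ q := by
          refine tsum_congr fun n => ?_
          rw [ENNReal.mul_rpow_of_nonneg _ _ hq.le, mul_comm]
      _ ≤ _ := this
      _ = _ := by
          rw [mul_comm, one_div_div p q]
          congr 3
          · funext n
            have hn : (0 : ℝ) < n + 1 := by positivity
            rw [← ENNReal.rpow_mul, ENNReal.ofReal_rpow_of_pos (by positivity),
              ← Real.rpow_mul hn.le]
            ring_nf
          · funext n
            rw [← ENNReal.rpow_mul, mul_div_cancel₀ _ hq.ne']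

/-- The points `2 ^ n` of the half plane. -/
noncomputable def dyadicPoint (n : ℕ) : RightHalfPlane :=
  ⟨((2 ^ n : ℝ) : ℂ), by rw [Complex.ofReal_re]; positivity⟩

/-- The weights `2^{n/r} (n + 1)^{-δ}`. -/
noncomputable def dyadicWeight (r δ : ℝ) (n : ℕ) : ℂ :=
  (((2 ^ n : ℝ) ^ (1 / r) * ((n : ℝ) + 1) ^ (-δ) : ℝ) : ℂ)

lemma enorm_dyadicWeight (r δ : ℝ) (n : ℕ) :
    ‖dyadicWeight r δ n‖ₑ =
      ENNReal.ofReal ((2 ^ n : ℝ) ^ (1 / r)) * ENNReal.ofReal (((n : ℝ) + 1) ^ (-δ)) := by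
  rw [dyadicWeight, ← ofReal_norm, Complex.norm_real, Real.norm_of_nonneg (by positivity),
    ENNReal.ofReal_mul (by positivity)]

lemma laplaceCarleson_dyadic {p p' q δ : ℝ} (hp2 : p ≤ 2) (hpp : p.HolderConjugate p')
    (hq : 1 < q) (hδ0 : 0 ≤ δ) (hδ : 1 / q - 1 / p < δ) :
    LaplaceCarleson p q dyadicPoint (dyadicWeight p' δ) := by
  have hp := hpp.pos
  have hq0 : 0 < q := by linarith
  obtain ⟨C, hC, hCle⟩ := exists_tsum_laplace_two_pow_le hp2 hpp
  obtain ⟨D, hD, hDle⟩ := exists_tsum_multiplier_le hp hq0 hδ0 hδ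
  have hKtop : D ^ (1 / q) * C ^ (1 / p) ≠ ∞ := ENNReal.mul_ne_top
    (ENNReal.rpow_ne_top_of_nonneg (by positivity) hD)
    (ENNReal.rpow_ne_top_of_nonneg (by positivity) hC)
  refine ⟨(D ^ (1 / q) * C ^ (1 / p)).toNNReal, fun τ hτ u hu => ?_⟩
  rw [ENNReal.coe_toNNReal hKtop, eLpNorm_discreteMeasure hq0,
    eLpNorm_eq_lintegral_rpow_enorm_toReal (by simpa using hp) (by simp),
    ENNReal.toReal_ofReal hp.le]
  have h1 := hDle fun n => ENNReal.ofReal ((2 ^ n) ^ (1 / p')) * ‖laplace τ u ((2 ^ n : ℝ) : ℂ)‖ₑ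
  have h2 := ENNReal.rpow_le_rpow (hCle τ u hu.1.aemeasurable) (show 0 ≤ q / p by positivity)
  have h3 := ENNReal.rpow_le_rpow (h1.trans (mul_le_mul_right h2 D)) (show 0 ≤ 1 / q by positivity)
  refine le_trans (le_of_eq ?_) (h3.trans (le_of_eq ?_))
  · congr 2
    funext n
    rw [enorm_mul, enorm_dyadicWeight, mul_right_comm, mul_comm]
    rfl
  · rw [ENNReal.mul_rpow_of_nonneg _ _ (by positivity), ← ENNReal.rpow_mul,
      show q / p * (1 / q) = 1 / p by field_simp, ENNReal.mul_rpow_of_nonneg _ _ (by positivity),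
      mul_assoc]

/-- The function equal to `2^{-k/r} (k + 1)^{-γ}` on `[2^k, 2^{k+1})`. -/
noncomputable def dyadicStep (r γ : ℝ) : ℝ → ℝ :=
  (Ici 1).indicator fun y =>
    (2 ^ (Nat.log 2 ⌊y⌋₊) : ℝ) ^ (-(1 / r)) * ((Nat.log 2 ⌊y⌋₊ : ℝ) + 1) ^ (-γ)

lemma dyadicStep_eq (r γ : ℝ) {k : ℕ} {y : ℝ} (hy : y ∈ Ico (2 ^ k : ℝ) (2 ^ (k + 1))) :
    dyadicStep r γ y = (2 ^ k : ℝ) ^ (-(1 / r)) * ((k : ℝ) + 1) ^ (-γ) := by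
  have h1 : y ∈ Ici (1 : ℝ) := (one_le_pow₀ one_le_two).trans hy.1
  have hlog : Nat.log 2 ⌊y⌋₊ = k := by
    refine Nat.log_eq_of_pow_le_of_lt_pow (Nat.le_floor ?_) ?_
    · exact_mod_cast hy.1
    · rw [Nat.floor_lt (by linarith [show (1 : ℝ) ≤ y from h1])]
      exact_mod_cast hy.2
  rw [dyadicStep, indicator_of_mem h1, hlog]

lemma measurable_dyadicStep (r γ : ℝ) : Measurable (dyadicStep r γ) := by
  refine Measurable.indicator ?_ measurableSet_Ici
  exact (measurable_of_countable fun k : ℕ => (2 ^ (Nat.log 2 k) : ℝ) ^ (-(1 / r)) *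
    ((Nat.log 2 k : ℝ) + 1) ^ (-γ)).comp Nat.measurable_floor

lemma dyadicStep_nonneg (r γ : ℝ) (y : ℝ) : 0 ≤ dyadicStep r γ y :=
  indicator_nonneg (fun y _ => by positivity) y

lemma dyadicStep_le_one {r γ : ℝ} (hr : 0 < r) (hγ : 0 ≤ γ) (y : ℝ) : dyadicStep r γ y ≤ 1 := by
  refine indicator_le' (fun y _ => ?_) (fun _ _ => zero_le_one) y
  refine mul_le_one₀ ?_ (by positivity) ?_
  · exact Real.rpow_le_one_of_one_le_of_nonpos (one_le_pow₀ one_le_two)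
      (neg_nonpos.2 (by positivity))
  · exact Real.rpow_le_one_of_one_le_of_nonpos (by simp) (by linarith)

lemma Ici_one_subset_iUnion : Ici (1 : ℝ) ⊆ ⋃ k : ℕ, Ico (2 ^ k : ℝ) (2 ^ (k + 1)) := by
  intro y hy
  obtain ⟨k, hk1, hk2⟩ := exists_nat_pow_near (show (1 : ℝ) ≤ y from hy) one_lt_two
  exact mem_iUnion.2 ⟨k, hk1, hk2⟩

/-- The shell length `2^k` cancels the factor `2^{-k}`, leaving `∑ (k+1)^{-γr}` with `γr > 1`. -/
lemma memLp_dyadicStep {r γ : ℝ} (hr : 0 < r) (hγ : 1 / r < γ) :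
    MemLp (fun y => (dyadicStep r γ y : ℂ)) (ENNReal.ofReal r) := by
  refine ⟨(measurable_dyadicStep r γ).complex_ofReal.aestronglyMeasurable, ?_⟩
  rw [eLpNorm_lt_top_iff_lintegral_rpow_enorm_lt_top (by simpa using hr) (by simp),
    ENNReal.toReal_ofReal hr.le, lt_top_iff_ne_top]
  have hσ : 1 < γ * r := by
    rw [div_lt_iff₀ hr] at hγ
    exact hγ
  refine ne_top_of_le_ne_top (tsum_ofReal_rpow_ne_top hσ) ?_
  calc ∫⁻ y, ‖(dyadicStep r γ y : ℂ)‖ₑ ^ r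
      ≤ ∫⁻ y in Ici (1 : ℝ), ‖(dyadicStep r γ y : ℂ)‖ₑ ^ r := by
        rw [← lintegral_indicator measurableSet_Ici]
        refine lintegral_mono fun y => ?_
        by_cases hy : y ∈ Ici (1 : ℝ)
        · rw [indicator_of_mem hy]
        · rw [indicator_of_notMem hy, dyadicStep, indicator_of_notMem hy]
          simp [hr]
    _ ≤ ∑' k : ℕ, ∫⁻ y in Ico (2 ^ k : ℝ) (2 ^ (k + 1)), ‖(dyadicStep r γ y : ℂ)‖ₑ ^ r :=
        (lintegral_mono_set Ici_one_subset_iUnion).trans (lintegral_iUnion_le _ _)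
    _ = ∑' k : ℕ, ENNReal.ofReal (((k : ℝ) + 1) ^ (-(γ * r))) := by
        refine tsum_congr fun k => ?_
        have h2 : (0 : ℝ) < 2 ^ k := by positivity
        rw [setLIntegral_congr_fun (g := fun _ => ENNReal.ofReal
          (((2 ^ k : ℝ) ^ (-(1 / r)) * ((k : ℝ) + 1) ^ (-γ)) ^ r)) measurableSet_Ico,
          setLIntegral_const, Real.volume_Ico, ← ENNReal.ofReal_mul (by positivity)]
        · congr 1
          rw [Real.mul_rpow (by positivity) (by positivity), ← Real.rpow_mul h2.le,
            ← Real.rpow_mul (by positivity), show -(1 / r) * r = -1 by field_simp,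
            Real.rpow_neg_one, pow_succ]
          field_simp
          ring
        · intro y hy
          simp only
          rw [← ofReal_norm, Complex.norm_real, Real.norm_of_nonneg (dyadicStep_nonneg _ _ _),
            dyadicStep_eq r γ hy, ENNReal.ofReal_rpow_of_nonneg (by positivity) hr.le]

/-- Only the shell `[2^n, 2^{n+1})` is kept. There `t² + y² ≤ 5t²` with `t = 2^n`, so the kernel is
at least `1/(5πt)`, and the shell has length `t`. -/
lemma le_norm_poissonExt_dyadicStep {r γ : ℝ} (hr : 0 < r) (hγ : 0 ≤ γ) (n : ℕ) :
    (5 * π)⁻¹ * ((2 ^ n : ℝ) ^ (-(1 / r)) * ((n : ℝ) + 1) ^ (-γ)) ≤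
      ‖poissonExt (fun y => (dyadicStep r γ y : ℂ)) (dyadicPoint n)‖ := by
  have h2 : (0 : ℝ) < 2 ^ n := by positivity
  have hpi := Real.pi_pos
  have hre : (dyadicPoint n : ℂ).re = 2 ^ n := Complex.ofReal_re _
  have him : (dyadicPoint n : ℂ).im = 0 := Complex.ofReal_im _
  have heq : poissonExt (fun y => (dyadicStep r γ y : ℂ)) (dyadicPoint n) =
      ((∫ y, poissonKernel (2 ^ n) (0 - y) * dyadicStep r γ y : ℝ) : ℂ) := by
    rw [poissonExt, hre, him, ← integral_complex_ofReal]
    push_cast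
    rfl
  have hnn : ∀ y, 0 ≤ poissonKernel (2 ^ n) (0 - y) * dyadicStep r γ y := fun y =>
    mul_nonneg (poissonKernel_nonneg h2 _) (dyadicStep_nonneg _ _ _)
  have hint : Integrable fun y => poissonKernel (2 ^ n) (0 - y) * dyadicStep r γ y := by
    refine ((integrable_poissonKernel h2).comp_sub_left 0).mul_bdd (c := 1)
      (measurable_dyadicStep r γ).aestronglyMeasurable (Filter.Eventually.of_forall fun y => ?_)
    rw [Real.norm_of_nonneg (dyadicStep_nonneg _ _ _)]
    exact dyadicStep_le_one hr hγ y
  rw [heq, Complex.norm_real, Real.norm_of_nonneg (integral_nonneg hnn)]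
  set v := (2 ^ n : ℝ) ^ (-(1 / r)) * ((n : ℝ) + 1) ^ (-γ) with hv
  calc (5 * π)⁻¹ * v = ∫ y in Ico (2 ^ n : ℝ) (2 ^ (n + 1)), (5 * π * 2 ^ n)⁻¹ * v := by
        rw [setIntegral_const, Real.volume_real_Ico_of_le (by rw [pow_succ]; linarith), smul_eq_mul,
          pow_succ]
        field_simp
        ring
    _ ≤ ∫ y in Ico (2 ^ n : ℝ) (2 ^ (n + 1)), poissonKernel (2 ^ n) (0 - y) * dyadicStep r γ y := by
        refine setIntegral_mono_on
          (continuous_const.integrableOn_Icc.mono_set Ico_subset_Icc_self) hint.integrableOn measurableSet_Ico fun y hy => ?_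
        rw [dyadicStep_eq r γ hy]
        refine mul_le_mul_of_nonneg_right ?_ (by positivity)
        have hy0 : 0 < y := h2.trans_le hy.1
        have hy2 : y < 2 * 2 ^ n := by
          have := hy.2
          rw [pow_succ] at this
          linarith
        rw [poissonKernel, zero_sub, neg_sq, inv_eq_one_div, div_le_div_iff₀ (by positivity)
          (by positivity)]
        have hsq : y ^ 2 ≤ (2 * 2 ^ n) ^ 2 := by gcongr
        nlinarith
    _ ≤ _ := setIntegral_le_integral hint (Filter.Eventually.of_forall hnn)

/-- The choice `γ = 1/q - δ` makes the `n`-th term of the `L^q(μ)` sum at least a multiple of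
`1/(n+1)`, while `γ > 1/r` keeps the test function in `L^r`. -/
lemma not_isEmbeddingCarleson_dyadic {q α r δ : ℝ} (hq : 0 < q) (hα : α * q = r) (hr : 0 < r)
    (hδ : 1 / r < 1 / q - δ) :
    ¬ IsEmbeddingCarleson α q (discreteMeasure q dyadicPoint (dyadicWeight r δ)) := by
  rintro ⟨M, hM⟩
  set γ := 1 / q - δ with hγ
  have hγ0 : 0 ≤ γ := le_trans (by positivity) hδ.le
  rw [hα] at hM
  have hmem := memLp_dyadicStep hr hδ
  have h1 := (hM _ hmem).trans_lt (ENNReal.mul_lt_top ENNReal.coe_lt_top hmem.2)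
  rw [eLpNorm_discreteMeasure hq] at h1
  refine h1.ne ?_
  rw [ENNReal.rpow_eq_top_iff_of_pos (by positivity), ← top_le_iff]
  have hc : 0 < (5 * π)⁻¹ := by positivity
  have hterm : ∀ n : ℕ, ENNReal.ofReal ((5 * π)⁻¹ ^ q) * ENNReal.ofReal (((n : ℝ) + 1) ^ (-1 : ℝ)) ≤
      ‖dyadicWeight r δ n * poissonExt (fun y => (dyadicStep r γ y : ℂ)) (dyadicPoint n)‖ₑ ^ q := by
    intro n
    have h2 : (0 : ℝ) < 2 ^ n := by positivity
    have hn : (0 : ℝ) < n + 1 := by positivity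
    have hw : ‖dyadicWeight r δ n‖ = (2 ^ n : ℝ) ^ (1 / r) * ((n : ℝ) + 1) ^ (-δ) := by
      rw [dyadicWeight, Complex.norm_real, Real.norm_of_nonneg (by positivity)]
    rw [← ENNReal.ofReal_mul (by positivity), ← ofReal_norm,
      ENNReal.ofReal_rpow_of_nonneg (norm_nonneg _) hq.le]
    refine ENNReal.ofReal_le_ofReal ?_
    have heq : ((n : ℝ) + 1) ^ (-1 : ℝ) = (((n : ℝ) + 1) ^ (-δ + -γ)) ^ q := by
      rw [← Real.rpow_mul hn.le, hγ]
      congr 1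
      field_simp
      ring
    rw [heq, ← Real.mul_rpow (by positivity) (by positivity), norm_mul, hw]
    refine Real.rpow_le_rpow (by positivity) ?_ hq.le
    refine le_trans (le_of_eq ?_) (mul_le_mul_of_nonneg_left
      (le_norm_poissonExt_dyadicStep hr hγ0 n) (by positivity))
    rw [Real.rpow_add hn, Real.rpow_neg h2.le (1 / r)]
    have : (2 ^ n : ℝ) ^ (1 / r) ≠ 0 := by positivity
    field_simp
  refine le_trans ?_ (ENNReal.tsum_le_tsum hterm)
  rw [ENNReal.tsum_mul_left, tsum_ofReal_rpow_neg_one, ENNReal.mul_top]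
  rw [Ne, ENNReal.ofReal_eq_zero, not_le]
  positivity

end

end CarlesonAdmissibility

/-! ### Assembly of the theorem -/

open CarlesonAdmissibility

theorem mainTheorem1 (p p' q α : ℝ) (hp : 1 < p) (hp2 : p ≤ 2) (hpp' : 1 / p + 1 / p' = 1)
    (hq : 1 < q) (hα : α * q = p') :
    (∀ (lam : ℕ → CarlesonAdmissibility.RightHalfPlane) (b : ℕ → ℂ),
      (CarlesonAdmissibility.IsEmbeddingCarleson α q
          (CarlesonAdmissibility.discreteMeasure q lam b) →
        (∀ θ : ℝ, 1 / p' < θ → b ∈ CarlesonAdmissibility.extrapolation q lam θ) ∧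
          CarlesonAdmissibility.IsAdmissible p hq lam b) ∧
      (CarlesonAdmissibility.IsAdmissible p hq lam b →
        (∀ θ : ℝ, 1 / p' < θ → b ∈ CarlesonAdmissibility.extrapolation q lam θ) ∧
          CarlesonAdmissibility.IsGeometricCarleson α
            (CarlesonAdmissibility.discreteMeasure q lam b)) ∧
      (p' ≤ q →
        (CarlesonAdmissibility.IsAdmissible p hq lam b ↔
          CarlesonAdmissibility.IsEmbeddingCarleson α q
            (CarlesonAdmissibility.discreteMeasure q lam b)) ∧
        (CarlesonAdmissibility.IsAdmissible p hq lam b ↔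
          CarlesonAdmissibility.IsGeometricCarleson α
            (CarlesonAdmissibility.discreteMeasure q lam b)))) ∧
    (p < 2 → q < p' →
      ∃ (lam : ℕ → CarlesonAdmissibility.RightHalfPlane) (b : ℕ → ℂ),
        CarlesonAdmissibility.IsAdmissible p hq lam b ∧
          ¬ CarlesonAdmissibility.IsEmbeddingCarleson α q
            (CarlesonAdmissibility.discreteMeasure q lam b)) := by
  have hpp : p.HolderConjugate p' := by
    rw [Real.holderConjugate_iff]
    exact ⟨hp, by simpa using hpp'⟩
  have hp'1 : 1 < p' := hpp.symm.lt
  have hp'0 : 0 < p' := by linarith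
  have hq0 : 0 < q := by linarith
  have hα0 : 0 < α := by
    by_contra! h
    nlinarith
  have hgeom : ∀ (lam : ℕ → RightHalfPlane) (b : ℕ → ℂ), LaplaceCarleson p q lam b →
      IsGeometricCarleson α (discreteMeasure q lam b) := fun lam b h =>
    h.isGeometricCarleson hp hpp' hp'0 hq hα
  have hmem : ∀ (lam : ℕ → RightHalfPlane) (b : ℕ → ℂ), LaplaceCarleson p q lam b →
      ∀ θ : ℝ, 1 / p' < θ → b ∈ extrapolation q lam θ := fun lam b h θ hθ =>
    (hgeom lam b h).mem_extrapolation hα0 hq (by rwa [hα])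
  have hadm : ∀ (lam : ℕ → RightHalfPlane) (b : ℕ → ℂ), LaplaceCarleson p q lam b →
      IsAdmissible p hq lam b := fun lam b h =>
    -- The requirement `b ∈ X_{-1}` is the case `θ = 1`, allowed because `1/p' < 1`.
    h.isAdmissible hp hq (hmem lam b h 1 ((div_lt_one hp'0).2 hp'1))
  have hemb : ∀ (lam : ℕ → RightHalfPlane) (b : ℕ → ℂ),
      IsEmbeddingCarleson α q (discreteMeasure q lam b) → LaplaceCarleson p q lam b :=
    fun lam b h => h.laplaceCarleson hp hp2 hpp' hp'0 hq hα
  refine ⟨fun lam b => ⟨fun h => ?_, fun h => ?_, fun hle => ?_⟩, fun hp2' hqp' => ?_⟩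
  · exact ⟨hmem lam b (hemb lam b h), hadm lam b (hemb lam b h)⟩
  · have hL := h.laplaceCarleson hp hq
    exact ⟨hmem lam b hL, hgeom lam b hL⟩
  · have hα1 : α ≤ 1 := by
      by_contra! h
      nlinarith
    have hduren : IsGeometricCarleson α (discreteMeasure q lam b) →
        IsEmbeddingCarleson α q (discreteMeasure q lam b) := fun h =>
      h.isEmbeddingCarleson hα0 hα1 hq (by rwa [hα])
    refine ⟨⟨fun h => hduren (hgeom lam b (h.laplaceCarleson hp hq)), fun h =>
      hadm lam b (hemb lam b h)⟩, ⟨fun h => hgeom lam b (h.laplaceCarleson hp hq), fun h =>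
      hadm lam b (hemb lam b (hduren h))⟩⟩
  · have hpp'lt : 1 / p' < 1 / p := by
      have h := hpp.sub_one_mul_conj
      exact one_div_lt_one_div_of_lt (by linarith) (by nlinarith)
    have hqp : 1 / p' < 1 / q := one_div_lt_one_div_of_lt hq0 hqp'
    -- The lower bound on `δ` gives admissibility, the upper bound destroys the embedding. The
    -- window is nonempty because `p < 2` forces `p < p'`, and it reaches positive `δ` because `q <
    -- p'`.
    obtain ⟨δ, hδ1, hδ2⟩ := exists_between (show max 0 (1 / q - 1 / p) < 1 / q - 1 / p' from
      max_lt (by linarith) (by linarith))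
    refine ⟨dyadicPoint, dyadicWeight p' δ, hadm _ _ (laplaceCarleson_dyadic hp2 hpp hq
      ((le_max_left _ _).trans hδ1.le) ((le_max_right _ _).trans_lt hδ1)), ?_⟩
    exact not_isEmbeddingCarleson_dyadic hq0 hα hp'0 (by linarith)
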